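/- Let $R(A_1,\dots,A_k)$ be a relation schema. A database $D$ over $R$ is a finite set of facts, where a fact $f$ assigns a constant $f[A_i]$ (coded as a natural number) to every attribute $A_i$. For an FD $\varphi = (X\to Y)$ with $X,Y\subseteq\{A_1,\dots,A_k\}$ and a set $E$ of facts, let $\mathsf{vio}(E,\varphi)$ be the set of all unordered pairs $\{f,g\}\subseteq E$ with $f[X]=g[X]$ and $f[Y]\neq g[Y]$. Given a finite set $\Delta$ of FDs and nonnegative rational weights $w_f$ (for $f\in D$) and $w_\varphi$ (for $\varphi\in\Delta$), the cost of a subset $E\subseteq D$ is $$\mathsf{cost}(E\mid D)=\sum_{f\in D\setminus E} w_f+\sum_{\varphi\in\Delta} w_\varphi\,|\mathsf{vio}(E,\varphi)|.$$ Soft repairing for the fixed schema $R(A_1,\dots,A_k)$ and the fixed set $\Delta$ is the following problem: given $D$ and all the weights $w_f$ and $w_\varphi$, each weight as a numerator and a denominator in binary, compute a subset $E\subseteq D$ of minimal cost. A matching constraint over $R(A_1,\dots,A_k)$ is a set $\Delta=\{X\to Y,\;X'\to Y'\}$ of FDs with $X\cup Y=X'\cup Y'=X\cup X'=\{A_1,\dots,A_k\}$.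 **Theorem.** For every relation schema $R(A_1,\dots,A_k)$ and every matching constraint $\Delta$ over it, soft repairing for $R(A_1,\dots,A_k)$ and $\Delta$ is solvable in time polynomial in the size of the input. -/

import Mathlib

namespace SoftRepair

/-! ### Relations, functional dependencies and soft repairing -/

/-- A fact over a schema with attributes `Fin k`. Constants are (coded by) natural numbers. -/
abbrev Fact (k : ℕ) : Type := Fin k → ℕ

/-- A functional dependency `lhs → rhs` over a schema with attributes `Fin k`. -/
structure FD (k : ℕ) where
  lhs : Finset (Fin k)
  rhs : Finset (Fin k)
deriving DecidableEq

/-- `f[X] = g[X]`. -/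
def Agree {k : ℕ} (X : Finset (Fin k)) (f g : Fact k) : Prop :=
  ∀ a ∈ X, f a = g a

instance {k : ℕ} (X : Finset (Fin k)) (f g : Fact k) : Decidable (Agree X f g) :=
  inferInstanceAs (Decidable (∀ a ∈ X, f a = g a))

/-- The set of violations of `φ` in `E`: unordered pairs `{f, g}` of facts of `E` that agree on
the left-hand side of `φ` and disagree on its right-hand side. -/
def vio {k : ℕ} (E : Finset (Fact k)) (φ : FD k) : Finset (Finset (Fact k)) :=
  (E.powersetCard 2).filter fun p =>
    ∃ f ∈ p, ∃ g ∈ p, Agree φ.lhs f g ∧ ¬ Agree φ.rhs f g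

/-- A nonnegative rational weight, represented by a numerator and a denominator
(not necessarily in lowest terms). -/
structure Weight where
  num : ℕ
  den : ℕ
  den_pos : 0 < den

/-- The rational number that a weight represents. -/
def Weight.value (w : Weight) : ℚ := (w.num : ℚ) / (w.den : ℚ)

/-- The cost of the subset `E` of the database `D`, with respect to a set `Δ` of FDs, weights
`wF` of the facts and weights `wC` of the FDs. -/
def cost {k : ℕ} (Δ : Finset (FD k)) (wF : Fact k → Weight) (wC : FD k → Weight)
    (D E : Finset (Fact k)) : ℚ :=
  (∑ f ∈ D \ E, (wF f).value) + ∑ φ ∈ Δ, (wC φ).value * ((vio E φ).card : ℚ)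

/-- `E` is an optimal subset of `D`. -/
def IsOptimalSubset {k : ℕ} (Δ : Finset (FD k)) (wF : Fact k → Weight) (wC : FD k → Weight)
    (D E : Finset (Fact k)) : Prop :=
  E ⊆ D ∧ ∀ E', E' ⊆ D → cost Δ wF wC D E ≤ cost Δ wF wC D E'

/-- The two FDs `X → Y` and `X' → Y'` form a matching constraint:
`X ∪ Y = X' ∪ Y' = X ∪ X'` is the set of all attributes. -/
def IsMatchingConstraint {k : ℕ} (φ ψ : FD k) : Prop :=
  φ.lhs ∪ φ.rhs = Finset.univ ∧ ψ.lhs ∪ ψ.rhs = Finset.univ ∧ φ.lhs ∪ ψ.lhs = Finset.univ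

/-! ### The model of computation

Programs are built by composition, pairing, branching and while loops from elementary operations
on binary trees whose leaves carry natural numbers. Natural numbers are measured by the length of
their binary representation, and every operation is charged for the complete size of the data that
it reads, copies or writes (logarithmic cost), so that running times are polynomially related to
those of Turing machines. -/

/-- Binary trees with natural numbers at the leaves. -/
inductive Data : Type
  | nat (n : ℕ) : Data
  | pair (a b : Data) : Data

/-- The size of a datum: the number of nodes of the tree plus the total number of bits of the
natural numbers at its leaves, in binary. -/
def Data.size : Data → ℕ
  | .nat n => 1 + Nat.size n
  | .pair a b => 1 + a.size + b.size

/-- Elementary operations. -/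
inductive Op : Type
  | skip : Op
  | const (d : Data) : Op
  | fst : Op
  | snd : Op
  | isPair : Op
  | add : Op
  | sub : Op
  | mul : Op

/-- The effect of an elementary operation. Operations applied to data of the wrong shape
return `0`. -/
def Op.apply : Op → Data → Data
  | .skip, x => x
  | .const d, _ => d
  | .fst, .pair a _ => a
  | .snd, .pair _ b => b
  | .isPair, .pair _ _ => .nat 1
  | .add, .pair (.nat m) (.nat n) => .nat (m + n)
  | .sub, .pair (.nat m) (.nat n) => .nat (m - n)
  | .mul, .pair (.nat m) (.nat n) => .nat (m * n)
  | _, _ => .nat 0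

/-- Programs. -/
inductive Prog : Type
  /-- perform an elementary operation -/
  | op (o : Op) : Prog
  /-- run `p`, then run `q` on the result -/
  | seq (p q : Prog) : Prog
  /-- run `p` and `q` on the same input, and return the pair of the results -/
  | fork (p q : Prog) : Prog
  /-- run `c` on the input; if the result is not `0` run `p` on the input, otherwise `q` -/
  | cond (c p q : Prog) : Prog
  /-- as long as `c` returns a result other than `0`, replace the current value `x` by the
  result of `p` on `x` -/
  | loop (c p : Prog) : Prog

/-- `Run p x y t`: on input `x`, the program `p` halts with output `y` after time `t`. -/
inductive Run : Prog → Data → Data → ℕ → Prop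
  | op (o : Op) (x : Data) : Run (.op o) x (o.apply x) (1 + x.size + (o.apply x).size)
  | seq {p q : Prog} {x y z : Data} {s t : ℕ} :
      Run p x y s → Run q y z t → Run (.seq p q) x z (1 + s + t)
  | fork {p q : Prog} {x y z : Data} {s t : ℕ} :
      Run p x y s → Run q x z t →
        Run (.fork p q) x (.pair y z) (1 + x.size + s + t + (Data.pair y z).size)
  | cond_true {c p q : Prog} {x b y : Data} {s t : ℕ} :
      Run c x b s → b ≠ .nat 0 → Run p x y t → Run (.cond c p q) x y (1 + x.size + s + t)
  | cond_false {c p q : Prog} {x y : Data} {s t : ℕ} :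
      Run c x (.nat 0) s → Run q x y t → Run (.cond c p q) x y (1 + x.size + s + t)
  | loop_done {c p : Prog} {x : Data} {s : ℕ} :
      Run c x (.nat 0) s → Run (.loop c p) x x (1 + x.size + s)
  | loop_step {c p : Prog} {x b y z : Data} {s t u : ℕ} :
      Run c x b s → b ≠ .nat 0 → Run p x y t → Run (.loop c p) y z u →
        Run (.loop c p) x z (1 + x.size + s + t + u)

/-- Programs are deterministic: the output and the running time are determined by the program
and its input. -/
theorem Run.deterministic {p : Prog} {x y z : Data} {s t : ℕ}
    (h : Run p x y s) (h' : Run p x z t) : y = z ∧ s = t := by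
  induction h generalizing z t with
  | op o x => cases h'; exact ⟨rfl, rfl⟩
  | seq _ _ ih₁ ih₂ =>
    cases h' with
    | seq a b =>
      obtain ⟨rfl, rfl⟩ := ih₁ a
      obtain ⟨rfl, rfl⟩ := ih₂ b
      exact ⟨rfl, rfl⟩
  | fork _ _ ih₁ ih₂ =>
    cases h' with
    | fork a b =>
      obtain ⟨rfl, rfl⟩ := ih₁ a
      obtain ⟨rfl, rfl⟩ := ih₂ b
      exact ⟨rfl, rfl⟩
  | cond_true _ hb _ ih₁ ih₂ =>
    cases h' with
    | cond_true a _ b =>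
      obtain ⟨rfl, rfl⟩ := ih₁ a
      obtain ⟨rfl, rfl⟩ := ih₂ b
      exact ⟨rfl, rfl⟩
    | cond_false a _ => exact absurd (ih₁ a).1 hb
  | cond_false _ _ ih₁ ih₂ =>
    cases h' with
    | cond_true a hb _ => exact absurd (ih₁ a).1.symm hb
    | cond_false a b =>
      obtain ⟨-, rfl⟩ := ih₁ a
      obtain ⟨rfl, rfl⟩ := ih₂ b
      exact ⟨rfl, rfl⟩
  | loop_done _ ih₁ =>
    cases h' with
    | loop_done a =>
      obtain ⟨-, rfl⟩ := ih₁ a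
      exact ⟨rfl, rfl⟩
    | loop_step a hb _ _ => exact absurd (ih₁ a).1.symm hb
  | loop_step _ hb _ _ ih₁ ih₂ ih₃ =>
    cases h' with
    | loop_done a => exact absurd (ih₁ a).1 hb
    | loop_step a _ b c =>
      obtain ⟨rfl, rfl⟩ := ih₁ a
      obtain ⟨rfl, rfl⟩ := ih₂ b
      obtain ⟨rfl, rfl⟩ := ih₃ c
      exact ⟨rfl, rfl⟩

/-! ### Soft repairing as a computational problem -/

/-- Lists as data: `0` is the empty list and a pair consists of head and tail. -/
def encodeList : List Data → Data
  | [] => .nat 0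
  | d :: l => .pair d (encodeList l)

/-- A fact is encoded as the list of its values. -/
def encodeFact {k : ℕ} (f : Fact k) : Data :=
  encodeList (List.ofFn fun i => Data.nat (f i))

/-- A weight is encoded as the pair of its numerator and its denominator. -/
def encodeWeight (w : Weight) : Data := .pair (.nat w.num) (.nat w.den)

/-- The input of soft repairing, for a database and a set of FDs that are listed as `L` and `Δ`:
the list of the weights of the FDs, and the list of the facts together with their weights. -/
def encodeInput {k : ℕ} (Δ : List (FD k)) (L : List (Fact k)) (wF : Fact k → Weight)
    (wC : FD k → Weight) : Data :=
  .pair (encodeList (Δ.map fun φ => encodeWeight (wC φ)))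
    (encodeList (L.map fun f => .pair (encodeFact f) (encodeWeight (wF f))))

/-- Soft repairing for the set of FDs listed by `Δ` is solvable in polynomial time: there are a
program and a polynomial such that for all databases `D`, presented as lists without repetitions,
and for all weights of facts and FDs, the program outputs (a list without repetitions of the facts
of) an optimal subset of `D` in time bounded by the polynomial in the size of the input. -/
def SolvableInPolyTime {k : ℕ} (Δ : List (FD k)) : Prop :=
  ∃ (p : Prog) (q : Polynomial ℕ),
    ∀ (L : List (Fact k)) (wF : Fact k → Weight) (wC : FD k → Weight), L.Nodup →
      ∃ (M : List (Fact k)) (t : ℕ), M.Nodup ∧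
        Run p (encodeInput Δ L wF wC) (encodeList (M.map encodeFact)) t ∧
        t ≤ q.eval (encodeInput Δ L wF wC).size ∧
        IsOptimalSubset Δ.toFinset wF wC L.toFinset M.toFinset

end SoftRepair

namespace SoftRepair

open Polynomial

/-! ### Encodings -/

/-! Since X ∪ Y is the whole schema, two distinct facts that agree on X always violate X → Y. A
class of n facts of E that agree on X thus contributes 0 + 1 + ... + (n - 1) violations. This is the
least total cost of giving the n facts different slots when the r-th slot of the class costs r, and
a larger supply of slots does not change it. The facts of D that agree on X serve as the slots, each
priced by its rank among them. The bounds in the two directions are `card_vio_le` and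
`exists_sum_eq_card_vio`.

Soft repairing thereby becomes an assignment problem. For every fact f there are persons and objects
`(true, f)` and `(false, f)`. Matching `(true, f)` to itself deletes f. Otherwise the object `(true,
f)` goes to a person `(false, g)`, a slot in the X-class of f, and the person `(true, f)` gets an
object `(false, g')`, a slot in its X'-class. Unused slots are matched to each other for free. All
other pairs cost `big`, more than deleting every fact, so an optimal assignment avoids them. The
lemmas `intCost_chosen_le` and `exists_assignment` translate between assignments and subsets.

The assignment problem is solved by an auction with ε-scaling. Unassigned persons bid for the
cheapest object and raise its price by ε, while ε runs through the powers of two down to 1. The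
result of one phase is optimal up to 2ε for the next. An alternating path argument
(`AuctionInv.price_le_of_path`) then bounds the rise of prices, so that quadratically many bids
suffice in every phase. The final error is at most the number of persons (`auction_spec`). All costs
are multiples of `scale`, which exceeds this number, so the result is exactly optimal. The weights
are made integral with a common denominator.

For the running time, functions computable in polynomial time are closed under composition, case
distinction and folds over lists whose accumulator grows by a bounded amount per step. -/

/-- Types whose elements are represented by data. -/
class Enc (α : Type) where
  enc : α → Data

open Enc (enc)

instance : Enc ℕ := ⟨Data.nat⟩
instance : Enc Bool := ⟨fun b => Data.nat b.toNat⟩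
instance {α β : Type} [Enc α] [Enc β] : Enc (α × β) := ⟨fun x => .pair (enc x.1) (enc x.2)⟩
instance {α : Type} [Enc α] : Enc (List α) := ⟨fun l => encodeList (l.map enc)⟩
instance {k : ℕ} : Enc (Fact k) := ⟨encodeFact⟩
instance : Enc Weight := ⟨encodeWeight⟩

section
variable {α β γ δ : Type} [Enc α] [Enc β] [Enc γ] [Enc δ]

/-- The size of the representation. -/
def esize (a : α) : ℕ := (enc a).size

theorem esize_nat (n : ℕ) : esize n = 1 + Nat.size n := rfl
theorem esize_pair (a : α) (b : β) : esize (a, b) = 1 + esize a + esize b := rfl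
theorem esize_nil : esize ([] : List α) = 1 := rfl
theorem esize_cons (a : α) (l : List α) : esize (a :: l) = 1 + esize a + esize l := rfl

theorem Data.size_pos (d : Data) : 0 < d.size := by
  cases d <;> simp only [Data.size] <;> omega

theorem esize_pos (a : α) : 0 < esize a := Data.size_pos _

theorem esize_append (l m : List α) : esize (l ++ m) + 1 = esize l + esize m := by
  induction l with
  | nil => simp only [List.nil_append, esize_nil]; omega
  | cons a l ih => simp only [List.cons_append, esize_cons]; omega

theorem esize_le_of_sublist {l m : List α} (h : l.Sublist m) : esize l ≤ esize m := by
  induction h with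
  | slnil => exact le_rfl
  | cons a _ ih => rw [esize_cons]; omega
  | cons_cons a _ ih => rw [esize_cons, esize_cons]; omega

theorem esize_perm {l m : List α} (h : l.Perm m) : esize l = esize m := by
  induction h with
  | nil => rfl
  | cons a _ ih => rw [esize_cons, esize_cons, ih]
  | swap a b l => simp only [esize_cons]; omega
  | trans _ _ ih₁ ih₂ => exact ih₁.trans ih₂

theorem length_lt_esize (l : List α) : l.length < esize l := by
  induction l with
  | nil => exact Nat.one_pos
  | cons a l ih => rw [esize_cons, List.length_cons]; have := esize_pos a; omega

theorem esize_le_of_mem {a : α} {l : List α} (h : a ∈ l) : esize a ≤ esize l := by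
  induction l with
  | nil => cases h
  | cons b l ih =>
    rw [esize_cons]
    rcases List.mem_cons.1 h with rfl | h
    · omega
    · have := ih h; omega

/-! ### Polynomially bounded functions -/

/-- Coefficients in ℕ make every polynomial monotone, so size bounds may be substituted into time
bounds. -/
theorem eval_mono (q : ℕ[X]) : Monotone fun n => q.eval n := by
  intro m n h
  simp only [Polynomial.eval_eq_sum_range]
  gcongr

/-- Functions that are bounded by a polynomial in the size of the argument. -/
def PolyBounded (g : α → ℕ) : Prop := ∃ q : ℕ[X], ∀ a, g a ≤ q.eval (esize a)

theorem PolyBounded.mono {g h : α → ℕ} (hh : PolyBounded h) (hg : ∀ a, g a ≤ h a) :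
    PolyBounded g :=
  hh.imp fun _ H a => (hg a).trans (H a)

theorem PolyBounded.const (c : ℕ) : PolyBounded fun _ : α => c := ⟨C c, fun a => by simp⟩

theorem PolyBounded.esize : PolyBounded (esize : α → ℕ) := ⟨X, fun a => by simp⟩

theorem PolyBounded.add {g h : α → ℕ} (hg : PolyBounded g) (hh : PolyBounded h) :
    PolyBounded fun a => g a + h a := by
  obtain ⟨q, hq⟩ := hg
  obtain ⟨r, hr⟩ := hh
  exact ⟨q + r, fun a => by rw [eval_add]; exact add_le_add (hq a) (hr a)⟩

theorem PolyBounded.mul {g h : α → ℕ} (hg : PolyBounded g) (hh : PolyBounded h) :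
    PolyBounded fun a => g a * h a := by
  obtain ⟨q, hq⟩ := hg
  obtain ⟨r, hr⟩ := hh
  exact ⟨q * r, fun a => by rw [eval_mul]; exact Nat.mul_le_mul (hq a) (hr a)⟩

theorem PolyBounded.eval {g : α → ℕ} (hg : PolyBounded g) (q : ℕ[X]) :
    PolyBounded fun a => q.eval (g a) := by
  obtain ⟨r, hr⟩ := hg
  exact ⟨q.comp r, fun a => by rw [eval_comp]; exact eval_mono q (hr a)⟩

theorem PolyBounded.comp {g : β → ℕ} {f : α → β} (hg : PolyBounded g)
    (hf : PolyBounded fun a => SoftRepair.esize (f a)) : PolyBounded fun a => g (f a) := by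
  obtain ⟨q, hq⟩ := hg
  exact (hf.eval q).mono fun a => hq _

/-! ### Functions computable in polynomial time -/

/-- `f` is computable in polynomial time. -/
@[fun_prop]
def PolyTime (f : α → β) : Prop :=
  ∃ p : Prog, ∃ T : α → ℕ, PolyBounded T ∧ ∀ a, ∃ t ≤ T a, Run p (enc a) (enc (f a)) t

/-- Every operation is charged for writing its output. Hence a time bound is also a bound for the
output size, which is what composition needs. -/
theorem Run.size_le {p : Prog} {x y : Data} {t : ℕ} (h : Run p x y t) : y.size ≤ t := by
  induction h <;> omega

theorem PolyTime.esize {f : α → β} (hf : PolyTime f) : PolyBounded fun a => esize (f a) := by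
  obtain ⟨p, T, hT, h⟩ := hf
  refine hT.mono fun a => ?_
  obtain ⟨t, ht, hr⟩ := h a
  exact hr.size_le.trans ht

/-- Elementary operations. -/
theorem PolyTime.of_op {f : α → β} (o : Op) (h : ∀ a, o.apply (enc a) = enc (f a))
    (hf : PolyBounded fun a => SoftRepair.esize (f a)) : PolyTime f := by
  refine ⟨.op o, fun a => 1 + SoftRepair.esize a + SoftRepair.esize (f a),
    ((PolyBounded.const 1).add .esize).add hf, fun a => ⟨_, le_rfl, ?_⟩⟩
  have := Run.op o (enc a)
  rwa [h] at this

@[fun_prop]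
theorem PolyTime.id : PolyTime fun a : α => a := .of_op .skip (fun _ => rfl) .esize

@[fun_prop]
theorem PolyTime.const (b : β) : PolyTime fun _ : α => b :=
  .of_op (.const (enc b)) (fun _ => rfl) (.const _)

theorem PolyTime.comp {g : β → γ} {f : α → β} (hg : PolyTime g) (hf : PolyTime f) :
    PolyTime fun a => g (f a) := by
  have hs := hf.esize
  obtain ⟨p, T, hT, h⟩ := hf
  obtain ⟨p', T', hT', h'⟩ := hg
  refine ⟨.seq p p', fun a => 1 + T a + T' (f a),
    ((PolyBounded.const 1).add hT).add (hT'.comp hs), fun a => ?_⟩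
  obtain ⟨t, ht, hr⟩ := h a
  obtain ⟨t', ht', hr'⟩ := h' (f a)
  exact ⟨_, by dsimp only; omega, hr.seq hr'⟩

attribute [fun_prop] PolyTime.comp

@[fun_prop]
theorem PolyTime.fst {f : α → β × γ} (hf : PolyTime f) : PolyTime fun a => (f a).1 :=
  PolyTime.comp (g := Prod.fst) (.of_op .fst (fun _ => rfl)
    (PolyBounded.esize.mono fun a => by rw [← Prod.mk.eta (p := a), esize_pair]; dsimp; omega)) hf

@[fun_prop]
theorem PolyTime.snd {f : α → β × γ} (hf : PolyTime f) : PolyTime fun a => (f a).2 :=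
  PolyTime.comp (g := Prod.snd) (.of_op .snd (fun _ => rfl)
    (PolyBounded.esize.mono fun a => by rw [← Prod.mk.eta (p := a), esize_pair]; dsimp; omega)) hf

@[fun_prop]
theorem PolyTime.pair {f : α → β} {g : α → γ} (hf : PolyTime f) (hg : PolyTime g) :
    PolyTime fun a => (f a, g a) := by
  have hs := hf.esize
  have hs' := hg.esize
  obtain ⟨p, T, hT, h⟩ := hf
  obtain ⟨p', T', hT', h'⟩ := hg
  refine ⟨.fork p p', fun a => 1 + SoftRepair.esize a + T a + T' a +
      (1 + SoftRepair.esize (f a) + SoftRepair.esize (g a)),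
    ((((PolyBounded.const 1).add .esize).add hT).add hT').add (((PolyBounded.const 1).add hs).add
      hs'), fun a => ?_⟩
  obtain ⟨t, ht, hr⟩ := h a
  obtain ⟨t', ht', hr'⟩ := h' a
  refine ⟨_, ?_, hr.fork hr'⟩
  simp only [Data.size, SoftRepair.esize]
  omega

theorem enc_bool_ne_zero {b : Bool} : enc b ≠ .nat 0 ↔ b = true := by
  cases b <;> simp [enc]

@[fun_prop]
theorem PolyTime.cond {c : α → Bool} {f g : α → β} (hc : PolyTime c) (hf : PolyTime f)
    (hg : PolyTime g) : PolyTime fun a => bif c a then f a else g a := by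
  obtain ⟨p, T, hT, h⟩ := hf
  obtain ⟨p', T', hT', h'⟩ := hg
  obtain ⟨pc, Tc, hTc, hc⟩ := hc
  refine ⟨.cond pc p p', fun a => 1 + SoftRepair.esize a + Tc a + T a + T' a,
    ((((PolyBounded.const 1).add .esize).add hTc).add hT).add hT', fun a => ?_⟩
  obtain ⟨t, ht, hr⟩ := h a
  obtain ⟨t', ht', hr'⟩ := h' a
  obtain ⟨s, hs, hrs⟩ := hc a
  dsimp only
  rcases hb : c a with _ | _
  · rw [hb] at hrs
    refine ⟨_, ?_, Run.cond_false hrs hr'⟩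
    simp only [SoftRepair.esize]; omega
  · rw [hb] at hrs
    refine ⟨_, ?_, Run.cond_true hrs (enc_bool_ne_zero.2 rfl) hr⟩
    simp only [SoftRepair.esize]; omega

/-- Loops with polynomially many rounds and values of polynomial size. -/
theorem PolyTime.loop {c : β → Bool} {s : β → β} {g : α → β} {N B : α → ℕ} (hc : PolyTime c)
    (hs : PolyTime s) (hg : PolyTime g) (hN : PolyBounded N) (hB : PolyBounded B)
    (hcont : ∀ a, ∀ i < N a, c (s^[i] (g a)) = true) (hhalt : ∀ a, c (s^[N a] (g a)) = false)
    (hsize : ∀ a, ∀ i ≤ N a, SoftRepair.esize (s^[i] (g a)) ≤ B a) :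
    PolyTime fun a => s^[N a] (g a) := by
  obtain ⟨pc, Tc, ⟨qc, hqc⟩, hc⟩ := hc
  obtain ⟨ps, Ts, ⟨qs, hqs⟩, hs⟩ := hs
  obtain ⟨pg, Tg, hTg, hg⟩ := hg
  let R : α → ℕ := fun a => 1 + B a + qc.eval (B a) + qs.eval (B a)
  have hR : PolyBounded R := (((PolyBounded.const 1).add hB).add (hB.eval qc)).add (hB.eval qs)
  refine ⟨.seq pg (.loop pc ps), fun a => 1 + Tg a + (N a + 1) * R a,
    ((PolyBounded.const 1).add hTg).add ((hN.add (.const 1)).mul hR), fun a => ?_⟩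
  -- Here i rounds have been made and j are left; each round, like the final test, takes time at
  -- most `R a`.
  have key : ∀ j i, i + j = N a →
      ∃ t ≤ (j + 1) * R a, Run (.loop pc ps) (enc (s^[i] (g a))) (enc (s^[N a] (g a))) t := by
    intro j
    induction j with
    | zero =>
      intro i hi
      obtain rfl : i = N a := hi
      obtain ⟨t, ht, hr⟩ := hc (s^[N a] (g a))
      rw [hhalt a] at hr
      refine ⟨_, ?_, Run.loop_done hr⟩
      have h1 := hsize a _ le_rfl
      have h2 := (ht.trans (hqc _)).trans (eval_mono qc h1)
      simp only [SoftRepair.esize] at h1 h2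
      simp only [R]
      omega
    | succ j ih =>
      intro i hi
      obtain ⟨t, ht, hr⟩ := hc (s^[i] (g a))
      obtain ⟨u, hu, hru⟩ := hs (s^[i] (g a))
      obtain ⟨v, hv, hrv⟩ := ih (i + 1) (by omega)
      rw [hcont a i (by omega)] at hr
      rw [Function.iterate_succ_apply'] at hrv
      refine ⟨_, ?_, Run.loop_step hr (enc_bool_ne_zero.2 rfl) hru hrv⟩
      have h1 := hsize a i (by omega)
      have h2 := (ht.trans (hqc _)).trans (eval_mono qc h1)
      have h3 := (hu.trans (hqs _)).trans (eval_mono qs h1)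
      have h4 : (j + 1 + 1) * R a = (j + 1) * R a + R a := by ring
      simp only [SoftRepair.esize] at h1 h2 h3
      simp only [R] at h4 hv ⊢
      omega
  obtain ⟨t, ht, hr⟩ := hg a
  obtain ⟨u, hu, hru⟩ := key (N a) 0 (by omega)
  exact ⟨_, by dsimp only; omega, hr.seq hru⟩

/-! ### Natural numbers and Booleans -/

theorem size_add_le (m n : ℕ) : Nat.size (m + n) ≤ Nat.size m + Nat.size n + 1 := by
  rw [Nat.size_le]
  have h1 := Nat.lt_size_self m
  have h2 := Nat.lt_size_self n
  have h3 : 2 ^ m.size ≤ 2 ^ (m.size + n.size) := Nat.pow_le_pow_right (by norm_num) (by omega)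
  have h4 : 2 ^ n.size ≤ 2 ^ (m.size + n.size) := Nat.pow_le_pow_right (by norm_num) (by omega)
  rw [pow_succ]
  omega

theorem size_mul_le (m n : ℕ) : Nat.size (m * n) ≤ Nat.size m + Nat.size n := by
  rw [Nat.size_le, pow_add]
  exact Nat.mul_lt_mul'' (Nat.lt_size_self m) (Nat.lt_size_self n)

@[fun_prop]
theorem PolyTime.add {f g : α → ℕ} (hf : PolyTime f) (hg : PolyTime g) :
    PolyTime fun a => f a + g a :=
  PolyTime.comp (g := fun x : ℕ × ℕ => x.1 + x.2) (.of_op .add (fun _ => rfl)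
    (PolyBounded.esize.mono fun ⟨m, n⟩ => by
      have := size_add_le m n; simp only [esize_pair, esize_nat]; omega)) (hf.pair hg)

@[fun_prop]
theorem PolyTime.sub {f g : α → ℕ} (hf : PolyTime f) (hg : PolyTime g) :
    PolyTime fun a => f a - g a :=
  PolyTime.comp (g := fun x : ℕ × ℕ => x.1 - x.2) (.of_op .sub (fun _ => rfl)
    (PolyBounded.esize.mono fun ⟨m, n⟩ => by
      have := Nat.size_le_size (Nat.sub_le m n); simp only [esize_pair, esize_nat]; omega))
    (hf.pair hg)

@[fun_prop]
theorem PolyTime.mul {f g : α → ℕ} (hf : PolyTime f) (hg : PolyTime g) :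
    PolyTime fun a => f a * g a :=
  PolyTime.comp (g := fun x : ℕ × ℕ => x.1 * x.2) (.of_op .mul (fun _ => rfl)
    (PolyBounded.esize.mono fun ⟨m, n⟩ => by
      have := size_mul_le m n; simp only [esize_pair, esize_nat]; omega)) (hf.pair hg)

/-- The test whether a number is different from zero. -/
theorem PolyTime.ne_zero : PolyTime fun n : ℕ => decide (n ≠ 0) := by
  refine ⟨.cond (.op .skip) (.op (.const (.nat 1))) (.op (.const (.nat 0))),
    fun n => 20 + 10 * SoftRepair.esize n,
    (PolyBounded.const 20).add ((PolyBounded.const 10).mul .esize), fun n => ?_⟩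
  rcases eq_or_ne n 0 with rfl | h
  · refine ⟨_, ?_, Run.cond_false (.op _ _) (.op _ _)⟩
    decide
  · have h1 : enc (decide (n ≠ 0)) = .nat 1 := by simp [enc, h]
    have h2 : Op.skip.apply (enc n) = enc n := rfl
    have h3 : (Data.nat 1).size = 2 := rfl
    dsimp only
    rw [h1]
    refine ⟨_, ?_, Run.cond_true (.op _ _) (by simpa [Op.apply, enc] using h) (.op _ _)⟩
    rw [h2, Op.apply, h3, SoftRepair.esize]
    omega

-- Truncated subtraction decides the order: g - f is nonzero exactly if f < g.
@[fun_prop]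
theorem PolyTime.decide_lt {f g : α → ℕ} (hf : PolyTime f) (hg : PolyTime g) :
    PolyTime fun a => decide (f a < g a) := by
  convert PolyTime.ne_zero.comp (hg.sub hf) using 2
  simp only [decide_eq_decide]
  omega

@[fun_prop]
theorem PolyTime.not {f : α → Bool} (hf : PolyTime f) : PolyTime fun a => !f a := by
  have : PolyTime fun a => bif f a then false else true := by fun_prop
  convert this using 2 with a
  cases f a <;> rfl

@[fun_prop]
theorem PolyTime.and {f g : α → Bool} (hf : PolyTime f) (hg : PolyTime g) :
    PolyTime fun a => f a && g a := by
  have : PolyTime fun a => bif f a then g a else false := by fun_prop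
  convert this using 2 with a
  cases f a <;> rfl

@[fun_prop]
theorem PolyTime.decide_eq {f g : α → ℕ} (hf : PolyTime f) (hg : PolyTime g) :
    PolyTime fun a => decide (f a = g a) := by
  have : PolyTime fun a => !decide (f a < g a) && !decide (g a < f a) := by fun_prop
  convert this using 2 with a
  rw [Bool.eq_iff_iff]
  simp
  omega

/-! ### Lists -/

/-- Case distinction on a list. -/
def listCase (l : List γ) (z : β) (s : γ → List γ → β) : β :=
  match l with
  | [] => z
  | c :: l => s c l

-- A nonempty list and the pair of its head and tail are the same datum, so nothing has to be
-- computed.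
@[fun_prop]
theorem PolyTime.cons {f : α → β} {l : α → List β} (hf : PolyTime f) (hl : PolyTime l) :
    PolyTime fun a => f a :: l a :=
  PolyTime.comp (g := fun x : β × List β => x.1 :: x.2) (.of_op .skip (fun _ => rfl)
    PolyBounded.esize) (hf.pair hl)

/-- The empty list is encoded by a number and all other lists by pairs. -/
theorem PolyTime.isEmpty : PolyTime fun l : List β => !l.isEmpty :=
  .of_op .isPair (fun l => by cases l <;> rfl)
    ((PolyBounded.const 2).mono fun l => by cases l <;> simp [SoftRepair.esize, enc, Data.size])

theorem PolyTime.listCase {l : α → List γ} {z : α → β} {s : α → γ → List γ → β}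
    (hl : PolyTime l) (hz : PolyTime z)
    (hs : PolyTime fun x : α × (γ × List γ) => s x.1 x.2.1 x.2.2) :
    PolyTime fun a => listCase (l a) (z a) (s a) := by
  obtain ⟨pz, Tz, hTz, hz⟩ := hz
  obtain ⟨ps, Ts, hTs, hs⟩ := hs
  have hp : PolyTime fun a => (a, l a) := by fun_prop
  have hps := hp.esize
  obtain ⟨pl, Tl, hTl, hl'⟩ := hp
  obtain ⟨pe, Te, hTe, he⟩ := PolyTime.isEmpty.comp hl
  obtain ⟨q, hq⟩ := hTs
  refine ⟨.cond pe (.seq pl ps) pz, fun a => 1 + SoftRepair.esize a + Te a + (1 + Tl a +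
      q.eval (SoftRepair.esize (a, l a))) + Tz a,
    ((((PolyBounded.const 1).add .esize).add hTe).add (((PolyBounded.const 1).add hTl).add
      (hps.eval q))).add hTz, fun a => ?_⟩
  obtain ⟨t, ht, hr⟩ := hz a
  obtain ⟨u, hu, hru⟩ := he a
  obtain ⟨v, hv, hrv⟩ := hl' a
  dsimp only at hru hrv ⊢
  rcases hb : l a with _ | ⟨c, m⟩
  · rw [hb] at hru
    refine ⟨_, ?_, Run.cond_false hru hr⟩
    simp only [SoftRepair.esize]; omega
  · rw [hb] at hru hrv
    obtain ⟨w, hw, hrw⟩ := hs (a, c, m)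
    refine ⟨_, ?_, Run.cond_true hru (enc_bool_ne_zero.2 rfl) (hrv.seq hrw)⟩
    have := hw.trans (hq _)
    have h2 : SoftRepair.esize (a, c, m) = SoftRepair.esize (a, c :: m) := rfl
    rw [h2] at this
    simp only [SoftRepair.esize] at this ⊢
    omega

/-- Folding over a list, if the values have polynomial size. -/
theorem PolyTime.foldl {f : α → β → γ → β} {g : α → β} {l : α → List γ} {B : α → ℕ}
    (hf : PolyTime fun x : α × (β × γ) => f x.1 x.2.1 x.2.2) (hg : PolyTime g) (hl : PolyTime l)
    (hB : PolyBounded B)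
    (h : ∀ a n, SoftRepair.esize (((l a).take n).foldl (f a) (g a)) ≤ B a) :
    PolyTime fun a => (l a).foldl (f a) (g a) := by
  -- The state of the loop consists of the parameter, the accumulator and the rest of the list.
  let c : α × (β × List γ) → Bool := fun x => !x.2.2.isEmpty
  let s : α × (β × List γ) → α × (β × List γ) := fun x =>
    SoftRepair.listCase x.2.2 x fun d m => (x.1, f x.1 x.2.1 d, m)
  have hc : PolyTime c := PolyTime.isEmpty.comp (by fun_prop)
  have hs : PolyTime s := by
    refine PolyTime.listCase (by fun_prop) (by fun_prop) ?_
    refine .pair (by fun_prop) (.pair ?_ (by fun_prop))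
    exact hf.comp (f := fun x : (α × (β × List γ)) × (γ × List γ) => (x.1.1, x.1.2.1, x.2.1))
      (by fun_prop)
  have key : ∀ (a : α) (m : List γ) (b : β) (i : ℕ), i ≤ m.length →
      s^[i] (a, b, m) = (a, (m.take i).foldl (f a) b, m.drop i) := by
    intro a m
    induction m with
    | nil => intro b i hi; obtain rfl : i = 0 := by simpa using hi
             rfl
    | cons d m ih =>
      intro b i hi
      rcases i with _ | i
      · rfl
      · rw [Function.iterate_succ_apply]
        exact ih _ i (by simpa using hi)
  have := PolyTime.loop (c := c) (s := s) (g := fun a => (a, g a, l a))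
    (N := fun a => (l a).length) (B := fun a => 2 + SoftRepair.esize a + B a +
      SoftRepair.esize (l a)) hc hs (by fun_prop)
    (hl.esize.mono fun a => (length_lt_esize _).le)
    ((((PolyBounded.const 2).add .esize).add hB).add hl.esize)
    (fun a i hi => by
      rw [key _ _ _ _ hi.le]
      simp only [c]
      rw [List.drop_eq_getElem_cons hi]
      rfl)
    (fun a => by
      rw [key _ _ _ _ le_rfl]
      simp [c])
    (fun a i hi => by
      rw [key _ _ _ _ hi, esize_pair, esize_pair]
      have h1 := h a i
      have h2 := esize_le_of_sublist (List.drop_sublist i (l a))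
      omega)
  convert this.snd.fst using 2 with a
  rw [key _ _ _ _ le_rfl]
  simp

omit [Enc γ] in
theorem esize_foldl_le {f : β → γ → β} {G : ℕ} (l : List γ) (b : β)
    (h : ∀ b, ∀ c ∈ l, SoftRepair.esize (f b c) ≤ SoftRepair.esize b + G) :
    SoftRepair.esize (l.foldl f b) ≤ SoftRepair.esize b + l.length * G := by
  induction l generalizing b with
  | nil => simp
  | cons c l ih =>
    have h1 := ih (f b c) fun b d hd => h b d (List.mem_cons_of_mem _ hd)
    have h2 := h b c List.mem_cons_self
    have h3 : (l.length + 1) * G = l.length * G + G := by ring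
    rw [List.foldl_cons, List.length_cons]
    omega

/-- Folding over a list, if the size grows by a bounded amount in every step. -/
theorem PolyTime.foldl_of_growth {f : α → β → γ → β} {g : α → β} {l : α → List γ} {G : α → ℕ}
    (hf : PolyTime fun x : α × (β × γ) => f x.1 x.2.1 x.2.2) (hg : PolyTime g) (hl : PolyTime l)
    (hG : PolyBounded G)
    (h : ∀ a b, ∀ c ∈ l a, SoftRepair.esize (f a b c) ≤ SoftRepair.esize b + G a) :
    PolyTime fun a => (l a).foldl (f a) (g a) := by
  refine PolyTime.foldl (B := fun a => SoftRepair.esize (g a) + SoftRepair.esize (l a) * G a)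
    hf hg hl (hg.esize.add (hl.esize.mul hG)) fun a n => ?_
  refine (esize_foldl_le _ _ fun b c hc => h a b c (List.mem_of_mem_take hc)).trans ?_
  gcongr
  exact (List.length_take_le' _ _).trans (length_lt_esize _).le

@[fun_prop]
theorem PolyTime.reverse {l : α → List β} (hl : PolyTime l) : PolyTime fun a => (l a).reverse := by
  have : PolyTime fun a => (l a).foldl (fun r b => b :: r) [] := by
    refine PolyTime.foldl_of_growth (G := fun a => 1 + SoftRepair.esize (l a)) (by fun_prop)
      (by fun_prop) hl ((PolyBounded.const 1).add hl.esize) fun a b c hc => ?_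
    have := esize_le_of_mem hc
    rw [esize_cons]; omega
  convert this using 2 with a
  simp

/-- Folding from the right. -/
theorem PolyTime.foldr_of_growth {f : α → γ → β → β} {g : α → β} {l : α → List γ} {G : α → ℕ}
    (hf : PolyTime fun x : α × (β × γ) => f x.1 x.2.2 x.2.1) (hg : PolyTime g) (hl : PolyTime l)
    (hG : PolyBounded G)
    (h : ∀ a b, ∀ c ∈ l a, SoftRepair.esize (f a c b) ≤ SoftRepair.esize b + G a) :
    PolyTime fun a => (l a).foldr (f a) (g a) := by
  have := PolyTime.foldl_of_growth (f := fun a b c => f a c b) hf hg hl.reverse hG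
    fun a b c hc => h a b c (List.mem_reverse.1 hc)
  simpa using this

theorem PolyTime.map {f : α → γ → δ} {l : α → List γ}
    (hf : PolyTime fun x : α × γ => f x.1 x.2) (hl : PolyTime l) :
    PolyTime fun a => (l a).map (f a) := by
  obtain ⟨q, hq⟩ := hf.esize
  have : PolyTime fun a => (l a).foldr (fun c r => f a c :: r) [] := by
    refine PolyTime.foldr_of_growth (G := fun a => 1 + q.eval (SoftRepair.esize a +
        SoftRepair.esize (l a) + 1)) ?_ (by fun_prop) hl ((PolyBounded.const 1).add
        (((PolyBounded.esize.add hl.esize).add (.const 1)).eval q)) fun a b c hc => ?_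
    · refine .cons (hf.comp (f := fun x : α × (List δ × γ) => (x.1, x.2.2)) ?_) ?_ <;> fun_prop
    · have h1 := hq (a, c)
      have h2 := eval_mono q (show SoftRepair.esize (a, c) ≤ SoftRepair.esize a +
        SoftRepair.esize (l a) + 1 by have := esize_le_of_mem hc; rw [esize_pair]; omega)
      dsimp only at h1 h2
      rw [esize_cons]; omega
  convert this using 2 with a
  induction l a with
  | nil => rfl
  | cons c m ih => rw [List.map_cons, ih]; rfl

theorem PolyTime.filter {f : α → γ → Bool} {l : α → List γ}
    (hf : PolyTime fun x : α × γ => f x.1 x.2) (hl : PolyTime l) :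
    PolyTime fun a => (l a).filter (f a) := by
  have : PolyTime fun a => (l a).foldr (fun c r => bif f a c then c :: r else r) [] := by
    refine PolyTime.foldr_of_growth (G := fun a => 1 + SoftRepair.esize (l a)) ?_ (by fun_prop) hl
      ((PolyBounded.const 1).add hl.esize) fun a b c hc => ?_
    · refine .cond (hf.comp (f := fun x : α × (List γ × γ) => (x.1, x.2.2)) ?_) ?_ ?_ <;> fun_prop
    · have := esize_le_of_mem hc
      cases f a c <;> simp only [cond_true, cond_false, esize_cons] <;> omega
  convert this using 2 with a
  induction l a with
  | nil => rfl
  | cons c m ih =>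
    rw [List.foldr_cons, List.filter_cons, ih]
    cases f a c <;> rfl

@[fun_prop]
theorem PolyTime.append {l m : α → List β} (hl : PolyTime l) (hm : PolyTime m) :
    PolyTime fun a => l a ++ m a := by
  have : PolyTime fun a => (l a).foldr (fun c r => c :: r) (m a) := by
    refine PolyTime.foldr_of_growth (G := fun a => 1 + SoftRepair.esize (l a)) (by fun_prop)
      hm hl ((PolyBounded.const 1).add hl.esize) fun a b c hc => ?_
    have := esize_le_of_mem hc
    rw [esize_cons]; omega
  simpa using this

theorem PolyTime.flatMap {f : α → γ → List δ} {l : α → List γ}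
    (hf : PolyTime fun x : α × γ => f x.1 x.2) (hl : PolyTime l) :
    PolyTime fun a => (l a).flatMap (f a) := by
  have hm := PolyTime.map hf hl
  have : PolyTime fun a => ((l a).map (f a)).foldr (fun c r => c ++ r) [] := by
    refine PolyTime.foldr_of_growth (G := fun a => SoftRepair.esize ((l a).map (f a)))
      (by fun_prop) (by fun_prop) hm hm.esize fun a b c hc => ?_
    have := esize_le_of_mem hc
    have := esize_append c b
    omega
  convert this using 2 with a
  induction l a with
  | nil => rfl
  | cons c m ih => rw [List.flatMap_cons, ih]; rfl

@[fun_prop]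
theorem PolyTime.length {l : α → List β} (hl : PolyTime l) : PolyTime fun a => (l a).length := by
  have : PolyTime fun a => (l a).foldl (fun n _ => n + 1) 0 := by
    refine PolyTime.foldl_of_growth (G := fun a => 2) (by fun_prop)
      (by fun_prop) hl (.const 2) fun a b c hc => ?_
    have := size_add_le b 1
    simp only [esize_nat, Nat.size_one] at this ⊢
    omega
  simpa using this

@[fun_prop]
theorem PolyTime.sum {l : α → List ℕ} (hl : PolyTime l) : PolyTime fun a => (l a).sum := by
  have : PolyTime fun a => (l a).foldr (fun n m => n + m) 0 := by
    refine PolyTime.foldr_of_growth (G := fun a => SoftRepair.esize (l a)) (by fun_prop)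
      (by fun_prop) hl hl.esize fun a b c hc => ?_
    have := size_add_le c b
    have := esize_le_of_mem hc
    simp only [esize_nat] at this ⊢
    omega
  simpa [List.sum] using this

@[fun_prop]
theorem PolyTime.prod {l : α → List ℕ} (hl : PolyTime l) : PolyTime fun a => (l a).prod := by
  have : PolyTime fun a => (l a).foldr (fun n m => n * m) 1 := by
    refine PolyTime.foldr_of_growth (G := fun a => SoftRepair.esize (l a)) (by fun_prop)
      (by fun_prop) hl hl.esize fun a b c hc => ?_
    have := size_mul_le c b
    have := esize_le_of_mem hc
    simp only [esize_nat] at this ⊢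
    omega
  simpa [List.prod] using this

/-- Powers of two in decreasing order, the first of which is at least `n`. -/
def powersUpTo (n : ℕ) : List ℕ := (List.range (Nat.size n + 1)).reverse.map (2 ^ ·)

@[fun_prop]
theorem PolyTime.powersUpTo {f : α → ℕ} (hf : PolyTime f) :
    PolyTime fun a => powersUpTo (f a) := by
  let s : ℕ × (ℕ × List ℕ) → ℕ × (ℕ × List ℕ) := fun x => (x.1, 2 * x.2.1, 2 * x.2.1 :: x.2.2)
  have hs : ∀ n i, s^[i] (n, 1, [1]) =
      (n, 2 ^ i, (List.range (i + 1)).reverse.map (2 ^ ·)) := by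
    intro n i
    induction i with
    | zero => rfl
    | succ i ih =>
      rw [Function.iterate_succ_apply', ih, List.range_succ (n := i + 1)]
      simp [s, pow_succ, mul_comm]
  have hl : ∀ i, SoftRepair.esize ((List.range (i + 1)).reverse.map (2 ^ ·)) ≤
      1 + (i + 1) * (i + 3) := by
    intro i
    induction i with
    | zero => decide
    | succ i ih =>
      rw [List.range_succ, List.reverse_append, List.reverse_singleton, List.singleton_append,
        List.map_cons, esize_cons, esize_nat, Nat.size_pow]
      nlinarith
  -- The doubling stops at the first power exceeding n, which is 2 to the number of bits of n.
  have := (PolyTime.loop (c := fun x : ℕ × (ℕ × List ℕ) => !decide (x.1 < x.2.1)) (s := s)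
    (g := fun n : ℕ => (n, 1, [1])) (N := Nat.size)
    (B := fun n => 20 + 10 * (SoftRepair.esize n * SoftRepair.esize n))
    (by fun_prop) (by fun_prop) (by fun_prop)
    (PolyBounded.esize.mono fun n => by rw [esize_nat]; omega)
    ((PolyBounded.const 20).add ((PolyBounded.const 10).mul (.mul .esize .esize)))
    (fun n i hi => by
      rw [hs]
      simpa using Nat.lt_size.1 hi)
    (fun n => by
      rw [hs]
      simpa using Nat.lt_size_self n)
    (fun n i hi => by
      rw [hs, esize_pair, esize_pair, esize_nat, esize_nat, Nat.size_pow]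
      have := hl i
      nlinarith)).snd.snd.comp hf
  convert this using 2 with a
  rw [hs]
  rfl

end

/-! ### The auction algorithm for the assignment problem -/

section Auction
variable {P O : Type}

/-- The price that `i` has to pay in total for the object of the entry `e`. Entries consist of
an object, its price, and the list of its owners. -/
def totalPrice (c : P → O → ℕ) (i : P) (e : O × (ℕ × List P)) : ℕ := c i e.1 + e.2.1

/-- Move an entry with the least total price for `i` to the front. -/
def bringMin (c : P → O → ℕ) (i : P) (es : List (O × (ℕ × List P))) : List (O × (ℕ × List P)) :=
  es.foldl (fun r e => listCase r [e] fun b t =>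
    bif decide (totalPrice c i e < totalPrice c i b) then e :: b :: t else b :: e :: t) []

/-- The first person of the queue takes a cheapest object, raises its price by `ε`, and sends its
previous owner to the queue. -/
def bid (c : P → O → ℕ) (ε : ℕ) (s : List P × List (O × (ℕ × List P))) :
    List P × List (O × (ℕ × List P)) :=
  listCase s.1 s fun i q => listCase (bringMin c i s.2) s fun e r =>
    (e.2.2 ++ q, (e.1, e.2.1 + ε, [i]) :: r)

/-- A list that is long enough to index the bids in one phase of an auction. -/
def bidRounds (ps : List P) : List P :=
  (ps ++ ps ++ ps ++ ps).flatMap fun _ => ps ++ ps ++ ps ++ ps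

/-- A phase of the auction: all objects are offered at the present prices, and the price is
raised by `ε` in every bid. -/
def auctionPhase (c : P → O → ℕ) (ps : List P) (ε : ℕ) (es : List (O × (ℕ × List P))) :
    List (O × (ℕ × List P)) :=
  ((bidRounds ps).foldl (fun s _ => bid c ε s) (ps, es.map fun e => (e.1, e.2.1, []))).2

/-- The auction with decreasing `ε`. -/
def auction (c : P → O → ℕ) (ps : List P) (os : List O) (C : ℕ) : List (O × (ℕ × List P)) :=
  (powersUpTo C).foldl (fun es ε => auctionPhase c ps ε es) (os.map fun o => (o, 0, []))

theorem bringMin_spec (c : P → O → ℕ) (i : P) (es : List (O × (ℕ × List P))) (hes : es ≠ []) :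
    ∃ b t, bringMin c i es = b :: t ∧ (b :: t).Perm es ∧
      ∀ e ∈ es, totalPrice c i b ≤ totalPrice c i e := by
  induction es using List.reverseRecOn with
  | nil => exact absurd rfl hes
  | append_singleton l e ih =>
    rw [bringMin, List.foldl_append]
    change ∃ b t, listCase (bringMin c i l) _ _ = _ ∧ _
    rcases eq_or_ne l [] with rfl | hl
    · refine ⟨e, [], rfl, .refl _, ?_⟩
      simp
    · obtain ⟨b, t, h1, h2, h3⟩ := ih hl
      rw [h1, listCase]
      have hp : (e :: b :: t).Perm (l ++ [e]) :=
        (h2.cons e).trans (List.perm_append_singleton _ _).symm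
      by_cases h : totalPrice c i e < totalPrice c i b
      · refine ⟨e, b :: t, by simp [h], hp, fun d hd => ?_⟩
        rcases List.mem_append.1 hd with hd | hd
        · exact h.le.trans (h3 d hd)
        · rw [List.mem_singleton.1 hd]
      · refine ⟨b, e :: t, by simp [h], (List.Perm.swap _ _ _).trans hp, fun d hd => ?_⟩
        rcases List.mem_append.1 hd with hd | hd
        · exact h3 d hd
        · rw [List.mem_singleton.1 hd]; exact not_lt.1 h

theorem bringMin_perm (c : P → O → ℕ) (i : P) (es : List (O × (ℕ × List P))) :
    (bringMin c i es).Perm es := by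
  rcases eq_or_ne es [] with rfl | h
  · exact .refl _
  · obtain ⟨b, t, h1, h2, -⟩ := bringMin_spec c i es h
    rwa [h1]

theorem length_bidRounds (ps : List P) : (bidRounds ps).length = 16 * ps.length ^ 2 := by
  simp [bidRounds]
  ring

/-! ### Growth of the data and running time of the auction -/

variable {α : Type} [Enc α] [Enc P] [Enc O]

/-- Persons only move between the queue and the entries, so essentially only the one raised price
can grow. -/
theorem esize_bid_le (c : P → O → ℕ) (ε : ℕ) (s : List P × List (O × (ℕ × List P))) :
    esize (bid c ε s) ≤ esize s + (3 + esize ε) := by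
  obtain ⟨_ | ⟨i, q⟩, es⟩ := s
  · simp [bid, listCase]
  · have hp := bringMin_perm c i es
    simp only [bid, listCase]
    rcases h : bringMin c i es with _ | ⟨⟨o, p, m⟩, r⟩
    · simp
    · rw [h] at hp
      have h1 := esize_perm hp
      have h2 := esize_append m q
      have h3 := size_add_le p ε
      simp only [esize_pair, esize_cons, esize_nil, esize_nat] at h1 ⊢
      omega

theorem esize_clear_le (es : List (O × (ℕ × List P))) :
    esize (es.map fun e => (e.1, e.2.1, ([] : List P))) ≤ esize es := by
  induction es with
  | nil => exact le_rfl
  | cons e es ih =>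
    obtain ⟨o, p, m⟩ := e
    have := esize_pos m
    simp only [List.map_cons, esize_cons, esize_pair, esize_nil]
    omega

/-- The increment does not depend on the entries. A constant factor instead would compound over the
phases. -/
theorem esize_auctionPhase_le (c : P → O → ℕ) (ps : List P) (ε : ℕ)
    (es : List (O × (ℕ × List P))) :
    esize (auctionPhase c ps ε es) ≤
      esize es + (1 + esize ps + (bidRounds ps).length * (3 + esize ε)) := by
  have h1 := esize_foldl_le (f := fun s (_ : P) => bid c ε s) (bidRounds ps)
    (ps, es.map fun e => (e.1, e.2.1, [])) fun s _ _ => esize_bid_le c ε s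
  have h2 := esize_clear_le es
  rw [esize_pair ps] at h1
  have h3 : ∀ s : List P × List (O × (ℕ × List P)), esize s.2 ≤ esize s := fun ⟨q, r⟩ => by
    rw [esize_pair]; dsimp only; omega
  exact (h3 _).trans (h1.trans (by omega))

variable {c : α → P → O → ℕ}

theorem PolyTime.bringMin (hc : PolyTime fun x : α × (P × O) => c x.1 x.2.1 x.2.2) {i : α → P}
    {es : α → List (O × (ℕ × List P))} (hi : PolyTime i) (hes : PolyTime es) :
    PolyTime fun a => bringMin (c a) (i a) (es a) := by
  refine PolyTime.foldl_of_growth (G := fun a => 1 + SoftRepair.esize (es a)) ?_ (by fun_prop) hes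
    ((PolyBounded.const 1).add hes.esize) fun a b e he => ?_
  · refine PolyTime.listCase (by fun_prop) (by fun_prop) (.cond (.decide_lt ?_ ?_) (by fun_prop)
      (by fun_prop))
    · exact .add (hc.comp (f := fun x : (α × (List (O × (ℕ × List P)) × (O × (ℕ × List P)))) ×
        ((O × (ℕ × List P)) × List (O × (ℕ × List P))) => (x.1.1, i x.1.1, x.1.2.2.1))
        (by fun_prop)) (by fun_prop)
    · exact .add (hc.comp (f := fun x : (α × (List (O × (ℕ × List P)) × (O × (ℕ × List P)))) ×
        ((O × (ℕ × List P)) × List (O × (ℕ × List P))) => (x.1.1, i x.1.1, x.2.1.1))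
        (by fun_prop)) (by fun_prop)
  · have := esize_le_of_mem he
    rcases b with _ | ⟨d, b⟩
    · simp only [SoftRepair.listCase, esize_cons, esize_nil]; omega
    · simp only [SoftRepair.listCase, Bool.cond_decide]
      split_ifs <;> simp only [esize_cons] <;> omega

theorem PolyTime.bid (hc : PolyTime fun x : α × (P × O) => c x.1 x.2.1 x.2.2) {ε : α → ℕ}
    {s : α → List P × List (O × (ℕ × List P))} (hε : PolyTime ε) (hs : PolyTime s) :
    PolyTime fun a => bid (c a) (ε a) (s a) := by
  refine PolyTime.listCase (by fun_prop) hs (PolyTime.listCase ?_ (by fun_prop) (by fun_prop))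
  refine PolyTime.bringMin (c := fun x : α × (P × List P) => c x.1) ?_ (by fun_prop) (by fun_prop)
  exact hc.comp (f := fun x : (α × (P × List P)) × (P × O) => (x.1.1, x.2)) (by fun_prop)

theorem PolyTime.bidRounds {ps : α → List P} (hps : PolyTime ps) :
    PolyTime fun a => bidRounds (ps a) :=
  PolyTime.flatMap (by fun_prop) (by fun_prop)

theorem PolyTime.auctionPhase (hc : PolyTime fun x : α × (P × O) => c x.1 x.2.1 x.2.2)
    {ps : α → List P} {ε : α → ℕ} {es : α → List (O × (ℕ × List P))} (hps : PolyTime ps)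
    (hε : PolyTime ε) (hes : PolyTime es) :
    PolyTime fun a => auctionPhase (c a) (ps a) (ε a) (es a) := by
  refine .snd (PolyTime.foldl_of_growth (G := fun a => 3 + SoftRepair.esize (ε a)) ?_
    (.pair hps (.map (by fun_prop) hes)) hps.bidRounds ((PolyBounded.const 3).add hε.esize)
    fun a s _ _ => esize_bid_le _ _ _)
  refine PolyTime.bid (c := fun x : α × ((List P × List (O × (ℕ × List P))) × P) => c x.1) ?_
    (by fun_prop) (by fun_prop)
  exact hc.comp (f := fun x : (α × ((List P × List (O × (ℕ × List P))) × P)) × (P × O) =>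
    (x.1.1, x.2)) (by fun_prop)

theorem PolyTime.auction (hc : PolyTime fun x : α × (P × O) => c x.1 x.2.1 x.2.2)
    {ps : α → List P} {os : α → List O} {C : α → ℕ} (hps : PolyTime ps) (hos : PolyTime os)
    (hC : PolyTime C) : PolyTime fun a => auction (c a) (ps a) (os a) (C a) := by
  have hpw : PolyTime fun a => SoftRepair.powersUpTo (C a) := by fun_prop
  refine PolyTime.foldl_of_growth (G := fun a => 1 + SoftRepair.esize (ps a) +
      SoftRepair.esize (SoftRepair.bidRounds (ps a)) * (3 +
        SoftRepair.esize (SoftRepair.powersUpTo (C a)))) ?_ (.map (by fun_prop) hos) hpw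
    (((PolyBounded.const 1).add hps.esize).add (hps.bidRounds.esize.mul
      ((PolyBounded.const 3).add hpw.esize))) fun a es ε hε => ?_
  · refine PolyTime.auctionPhase (c := fun x : α × (List (O × (ℕ × List P)) × ℕ) => c x.1) ?_
      (by fun_prop) (by fun_prop) (by fun_prop)
    exact hc.comp (f := fun x : (α × (List (O × (ℕ × List P)) × ℕ)) × (P × O) =>
      (x.1.1, x.2)) (by fun_prop)
  · refine (esize_auctionPhase_le _ _ _ _).trans ?_
    gcongr
    · exact (length_lt_esize _).le
    · exact esize_le_of_mem hε

end Auction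

/-! ### Correctness of the auction -/

section AuctionSpec
variable {P O : Type}

/-- The prices `p` and the partial assignment `m` of persons to objects satisfy the invariants of
a phase of the auction that began with the prices `p₀`. -/
structure AuctionInv (c : P → O → ℕ) (ε : ℕ) (PS : Finset P) (OS : Finset O) (p₀ p : O → ℕ)
    (m : O → Option P) : Prop where
  mem : ∀ o ∈ OS, ∀ i, m o = some i → i ∈ PS
  inj : ∀ o ∈ OS, ∀ o' ∈ OS, ∀ i, m o = some i → m o' = some i → o = o'
  slack : ∀ o ∈ OS, ∀ i, m o = some i → ∀ o' ∈ OS, c i o + p o ≤ c i o' + p o' + ε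
  free : ∀ o ∈ OS, m o = none → p o = p₀ o
  bdd : ∀ o ∈ OS, p o ≤ p₀ o + (3 * PS.card + 3) * ε

/-- The assignment `τ` of objects to persons is injective and, at the prices `p`, optimal up to
`ε` for every person. -/
structure NearlyOptimal (c : P → O → ℕ) (ε : ℕ) (PS : Finset P) (OS : Finset O) (p : O → ℕ)
    (τ : P → O) : Prop where
  mapsTo : Set.MapsTo τ PS OS
  injOn : Set.InjOn τ PS
  slack : ∀ i ∈ PS, ∀ o ∈ OS, c i (τ i) + p (τ i) ≤ c i o + p o + ε

variable {c : P → O → ℕ} {ε : ℕ} {PS : Finset P} {OS : Finset O} {p₀ p : O → ℕ}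
  {m : O → Option P} {τ : P → O}

section
variable [DecidableEq P]

/-- Along an alternating path from an unassigned person, prices have risen by a bounded amount. -/
theorem AuctionInv.price_le_of_path (h : AuctionInv c ε PS OS p₀ p m)
    (hτ : NearlyOptimal c (2 * ε) PS OS p₀ τ) (n : ℕ) : ∀ (A : Finset P) (i : P), A ⊆ PS → i ∈ PS →
    i ∉ A → PS.card = A.card + n →
    (∀ j ∈ PS, ∀ j', m (τ j) = some j' → j' ∈ insert i A → j ∈ A) →
    p (τ i) ≤ p₀ (τ i) + 3 * ε * n := by
  induction n with
  | zero =>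
    intro A i hA hi hiA hc _
    exact absurd (Finset.eq_of_subset_of_card_le hA (by omega) ▸ hi) hiA
  | succ n ih =>
    intro A i hA hi hiA hc hback
    have hτi := hτ.mapsTo hi
    rcases hm : m (τ i) with _ | i'
    · rw [h.free _ hτi hm]; omega
    · have hi' := h.mem _ hτi _ hm
      -- The set A holds the persons visited before i. All predecessors of visited persons are
      -- visited, so the path cannot return and must end at an unassigned object, whose price is
      -- still the initial one.
      have hnot : i' ∉ insert i A := fun hmem => hiA (hback i hi i' hm hmem)
      have h1 := ih (insert i A) i' (Finset.insert_subset hi hA) hi' hnot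
        (by rw [Finset.card_insert_of_notMem hiA]; omega) (by
          intro j hj j' hj' hmem
          rcases Finset.mem_insert.1 hmem with rfl | hmem
          · have := hτ.injOn hj hi (h.inj _ (hτ.mapsTo hj) _ hτi _ hj' hm)
            exact this ▸ Finset.mem_insert_self _ _
          · exact Finset.mem_insert_of_mem (hback j hj j' hj' hmem))
      -- The owner i' of `τ i` prefers it to `τ i'` up to ε at the present prices, and prefers `τ
      -- i'` to it up to 2ε at the initial ones. Hence the rises of the two prices differ by at most
      -- 3ε.
      have h2 := h.slack _ hτi _ hm _ (hτ.mapsTo hi')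
      have h3 := hτ.slack i' hi' _ hτi
      have h4 : 3 * ε * (n + 1) = 3 * ε * n + 3 * ε := by ring
      omega

variable [DecidableEq O]

/-- A bid preserves the invariants. -/
theorem AuctionInv.bid (h : AuctionInv c ε PS OS p₀ p m)
    (hτ : NearlyOptimal c (2 * ε) PS OS p₀ τ) {i : P} (hi : i ∈ PS)
    (hfree : ∀ o ∈ OS, m o ≠ some i) {o : O} (ho : o ∈ OS)
    (hmin : ∀ o' ∈ OS, c i o + p o ≤ c i o' + p o') :
    AuctionInv c ε PS OS p₀ (Function.update p o (p o + ε)) (Function.update m o (some i)) where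
  mem o' ho' j hj := by
    rcases eq_or_ne o' o with rfl | hne
    · rw [Function.update_self] at hj
      exact Option.some.inj hj ▸ hi
    · rw [Function.update_of_ne hne] at hj
      exact h.mem _ ho' _ hj
  inj o₁ h₁ o₂ h₂ j hj₁ hj₂ := by
    by_cases e₁ : o₁ = o <;> by_cases e₂ : o₂ = o
    · rw [e₁, e₂]
    · subst e₁
      rw [Function.update_self] at hj₁
      rw [Function.update_of_ne e₂] at hj₂
      exact absurd (hj₂.trans hj₁.symm) (hfree _ h₂)
    · subst e₂
      rw [Function.update_self] at hj₂
      rw [Function.update_of_ne e₁] at hj₁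
      exact absurd (hj₁.trans hj₂.symm) (hfree _ h₁)
    · rw [Function.update_of_ne e₁] at hj₁
      rw [Function.update_of_ne e₂] at hj₂
      exact h.inj _ h₁ _ h₂ _ hj₁ hj₂
  slack o₁ h₁ j hj o₂ h₂ := by
    have hle : p o₂ ≤ Function.update p o (p o + ε) o₂ := by
      rcases eq_or_ne o₂ o with rfl | hne
      · rw [Function.update_self]; omega
      · rw [Function.update_of_ne hne]
    rcases eq_or_ne o₁ o with rfl | hne
    · rw [Function.update_self] at hj ⊢
      obtain rfl := Option.some.inj hj
      have := hmin o₂ h₂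
      omega
    · rw [Function.update_of_ne hne] at hj
      rw [Function.update_of_ne hne]
      have := h.slack _ h₁ _ hj _ h₂
      omega
  free o' ho' hn := by
    rcases eq_or_ne o' o with rfl | hne
    · simp at hn
    · rw [Function.update_of_ne hne] at hn ⊢
      exact h.free _ ho' hn
  bdd o' ho' := by
    rcases eq_or_ne o' o with rfl | hne
    · rw [Function.update_self]
      -- The path starts at the bidder, who owns nothing, so no person has been visited and no edge
      -- leads back.
      have h1 := h.price_le_of_path hτ PS.card ∅ i (Finset.empty_subset _) hi
        (Finset.notMem_empty _) (by simp) (by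
          intro j hj j' hj' hmem
          rw [Finset.mem_insert] at hmem
          rcases hmem with rfl | hmem
          · exact absurd hj' (hfree _ (hτ.mapsTo hj))
          · exact absurd hmem (Finset.notMem_empty _))
      -- Passing from `τ i` to the cheapest object o adds 2ε to the bound 3nε on the rise, and the
      -- bid itself adds ε.
      have h2 := hmin _ (hτ.mapsTo hi)
      have h3 := hτ.slack i hi _ ho
      have h4 : (3 * PS.card + 3) * ε = 3 * ε * PS.card + 3 * ε := by ring
      omega
    · rw [Function.update_of_ne hne]
      exact h.bdd _ ho'

end

/-- The list `es` of entries lists the objects `OS`, with prices `p` and owners `m`. -/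
structure Lists (OS : Finset O) (p : O → ℕ) (m : O → List P) (es : List (O × (ℕ × List P))) :
    Prop where
  nodup : (es.map Prod.fst).Nodup
  mem : ∀ o, o ∈ es.map Prod.fst ↔ o ∈ OS
  eq : ∀ e ∈ es, e = (e.1, p e.1, m e.1)

theorem Lists.perm {m : O → List P} {es es' : List (O × (ℕ × List P))} (h : Lists OS p m es)
    (hp : es'.Perm es) : Lists OS p m es' where
  nodup := ((hp.map _).nodup_iff).2 h.nodup
  mem o := ((hp.map _).mem_iff).trans (h.mem o)
  eq e he := h.eq e (hp.mem_iff.1 he)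

theorem Lists.update [DecidableEq O] {m : O → List P} {e : O × (ℕ × List P)}
    {es : List (O × (ℕ × List P))}
    (h : Lists OS p m (e :: es)) (x : ℕ) (l : List P) :
    Lists OS (Function.update p e.1 x) (Function.update m e.1 l) ((e.1, x, l) :: es) where
  nodup := h.nodup
  mem := h.mem
  eq d hd := by
    rcases List.mem_cons.1 hd with rfl | hd
    · simp
    · have hn := h.nodup
      rw [List.map_cons, List.nodup_cons] at hn
      have hne : d.1 ≠ e.1 := fun h' => hn.1 (h' ▸ List.mem_map_of_mem hd)
      rw [Function.update_of_ne hne, Function.update_of_ne hne]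
      exact h.eq d (List.mem_cons_of_mem _ hd)

/-- `s` is the state of the auction after `j` rounds. -/
def AuctionState (c : P → O → ℕ) (ε : ℕ) (PS : Finset P) (OS : Finset O) (p₀ : O → ℕ) (j : ℕ)
    (s : List P × List (O × (ℕ × List P))) : Prop :=
  ∃ p m, AuctionInv c ε PS OS p₀ p m ∧ Lists OS p (fun o => (m o).toList) s.2 ∧ s.1.Nodup ∧
    (∀ i, i ∈ s.1 ↔ i ∈ PS ∧ ∀ o ∈ OS, m o ≠ some i) ∧
    (s.1 = [] ∨ ∑ o ∈ OS, p o = ∑ o ∈ OS, p₀ o + j * ε)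

theorem AuctionState.bid [DecidableEq P] [DecidableEq O]
    (hτ : NearlyOptimal c (2 * ε) PS OS p₀ τ) {j : ℕ}
    {s : List P × List (O × (ℕ × List P))} (h : AuctionState c ε PS OS p₀ j s) :
    AuctionState c ε PS OS p₀ (j + 1) (SoftRepair.bid c ε s) := by
  obtain ⟨p, m, hinv, hl, hn, hq, hsum⟩ := h
  obtain ⟨_ | ⟨i, q⟩, es⟩ := s
  · exact ⟨p, m, hinv, hl, hn, hq, Or.inl rfl⟩
  · obtain ⟨hi, hfree⟩ := (hq i).1 List.mem_cons_self
    have hne : es ≠ [] := by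
      rintro rfl
      exact absurd ((hl.mem (τ i)).2 (hτ.mapsTo hi)) (by simp)
    obtain ⟨e, r, h1, h2, h3⟩ := bringMin_spec c i es hne
    have hl' := hl.perm h2
    have he := hl'.eq e List.mem_cons_self
    have ho : e.1 ∈ OS := (hl'.mem _).1 (by simp)
    have hmin : ∀ o' ∈ OS, c i e.1 + p e.1 ≤ c i o' + p o' := by
      intro o' ho'
      obtain ⟨d, hd, rfl⟩ := List.mem_map.1 ((hl.mem o').2 ho')
      have h4 := h3 d hd
      rw [hl.eq d hd, he] at h4
      exact h4
    have hown : e.2.2 = (m e.1).toList := congrArg (fun x => x.2.2) he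
    have hprice : e.2.1 = p e.1 := congrArg (fun x => x.2.1) he
    refine ⟨Function.update p e.1 (p e.1 + ε), Function.update m e.1 (some i),
      hinv.bid hτ hi hfree ho hmin, ?_, ?_, ?_, Or.inr ?_⟩
    · simp only [SoftRepair.bid, listCase, h1, hprice]
      convert hl'.update (p e.1 + ε) [i] using 1
      funext o
      by_cases h : o = e.1
      · subst h; simp
      · simp [Function.update_of_ne h]
    · simp only [SoftRepair.bid, listCase, h1, hown]
      refine List.Nodup.append (by cases m e.1 <;> simp) (List.nodup_cons.1 hn).2 ?_
      intro j hj hjq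
      exact ((hq j).1 (List.mem_cons_of_mem _ hjq)).2 _ ho (by simpa using hj)
    · intro j
      simp only [SoftRepair.bid, listCase, h1, hown, List.mem_append, Option.mem_toList]
      constructor
      · rintro (hj | hj)
        · refine ⟨hinv.mem _ ho _ hj, fun o ho' h' => ?_⟩
          by_cases hoe : o = e.1
          · subst hoe
            rw [Function.update_self] at h'
            exact hfree _ ho (hj.trans h'.symm)
          · rw [Function.update_of_ne hoe] at h'
            exact hoe (hinv.inj _ ho' _ ho _ h' hj)
        · obtain ⟨hjP, hjf⟩ := (hq j).1 (List.mem_cons_of_mem _ hj)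
          refine ⟨hjP, fun o ho' h' => ?_⟩
          by_cases hoe : o = e.1
          · subst hoe
            rw [Function.update_self] at h'
            obtain rfl := Option.some.inj h'
            exact (List.nodup_cons.1 hn).1 hj
          · rw [Function.update_of_ne hoe] at h'
            exact hjf _ ho' h'
      · rintro ⟨hjP, hjf⟩
        by_cases hj : m e.1 = some j
        · exact Or.inl hj
        · refine Or.inr ?_
          have hjq : j ∈ i :: q := (hq j).2 ⟨hjP, fun o ho' h' => by
            by_cases hoe : o = e.1
            · exact hj (hoe ▸ h')
            · exact hjf o ho' (by rwa [Function.update_of_ne hoe])⟩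
          rcases List.mem_cons.1 hjq with rfl | hjq
          · exact absurd (Function.update_self _ _ _) (hjf _ ho)
          · exact hjq
    · have hs : ∑ o ∈ OS, p o = ∑ o ∈ OS, p₀ o + j * ε :=
        hsum.resolve_left (List.cons_ne_nil _ _)
      rw [Finset.sum_update_of_mem ho, add_mul, one_mul, ← add_assoc, ← hs,
        ← Finset.add_sum_erase _ _ ho, Finset.sdiff_singleton_eq_erase]
      ring

/-- After sufficiently many rounds, all persons are assigned to objects. -/
theorem AuctionState.queue_eq_nil (hε : 0 < ε) (hcard : OS.card = PS.card) {j : ℕ}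
    (hj : 16 * PS.card ^ 2 ≤ j) {s : List P × List (O × (ℕ × List P))}
    (h : AuctionState c ε PS OS p₀ j s) : s.1 = [] := by
  obtain ⟨p, m, hinv, -, -, hq, hsum⟩ := h
  rcases hsum with hsum | hsum
  · exact hsum
  · by_contra hne
    obtain ⟨i, hi⟩ := List.exists_mem_of_ne_nil _ hne
    have hpos : 0 < PS.card := Finset.card_pos.2 ⟨i, ((hq i).1 hi).1⟩
    have h1 : ∑ o ∈ OS, p o ≤ ∑ o ∈ OS, (p₀ o + (3 * PS.card + 3) * ε) :=
      Finset.sum_le_sum hinv.bdd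
    rw [hsum, Finset.sum_add_distrib, Finset.sum_const, hcard, smul_eq_mul, ← mul_assoc] at h1
    have h2 := Nat.le_of_mul_le_mul_right (Nat.le_of_add_le_add_left h1) hε
    -- With n persons, j bids raise the prices by jε in total, so j ≤ n(3n + 3) ≤ 6n², which is less
    -- than 16n² as n > 0.
    nlinarith

/-- All objects are assigned, with slack `ε`. -/
def Assigned (c : P → O → ℕ) (ε : ℕ) (PS : Finset P) (OS : Finset O)
    (es : List (O × (ℕ × List P))) : Prop :=
  ∃ (p : O → ℕ) (m : O → P), Lists OS p (fun o => [m o]) es ∧ Set.MapsTo m OS PS ∧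
    Set.InjOn m OS ∧ ∀ o ∈ OS, ∀ o' ∈ OS, c (m o) o + p o ≤ c (m o) o' + p o' + ε

/-- The assignment τ from the preceding phase is not used by the algorithm; it only serves to bound
the prices and with them the number of bids. -/
theorem assigned_auctionPhase [DecidableEq P] [DecidableEq O] [Nonempty P] [Nonempty O]
    (hε : 0 < ε) (hcard : OS.card = PS.card) {ps : List P}
    (hps : ps.Nodup) (hmem : ∀ i, i ∈ ps ↔ i ∈ PS) {m₀ : O → List P}
    {es : List (O × (ℕ × List P))} (hes : Lists OS p₀ m₀ es)
    (hτ : NearlyOptimal c (2 * ε) PS OS p₀ τ) :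
    Assigned c ε PS OS (auctionPhase c ps ε es) := by
  have h0 : AuctionState c ε PS OS p₀ 0 (ps, es.map fun e => (e.1, e.2.1, [])) := by
    refine ⟨p₀, fun _ => none, ⟨by simp, by simp, by simp, by simp, by simp⟩, ⟨?_, ?_, ?_⟩, hps,
      by simp [hmem], by simp⟩
    · simpa [Function.comp_def] using hes.nodup
    · simpa [Function.comp_def] using hes.mem
    · intro d hd
      obtain ⟨e, he, rfl⟩ := List.mem_map.1 hd
      have := hes.eq e he
      rw [this]
      rfl
  have hfold : ∀ (l : List P) (j : ℕ) (s : List P × List (O × (ℕ × List P))),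
      AuctionState c ε PS OS p₀ j s →
      AuctionState c ε PS OS p₀ (j + l.length) (l.foldl (fun s _ => bid c ε s) s) := by
    intro l
    induction l with
    | nil => exact fun j s h => h
    | cons a l ih =>
      intro j s h
      have := ih (j + 1) _ (h.bid hτ)
      rwa [add_assoc, add_comm 1] at this
  have h1 := hfold (bidRounds ps) 0 _ h0
  have hlen : ps.length = PS.card := by
    rw [← List.toFinset_card_of_nodup hps]
    congr 1
    ext i
    simp [hmem]
  have h2 := h1.queue_eq_nil hε hcard (by rw [length_bidRounds, hlen, zero_add])
  obtain ⟨p, m, hinv, hl, -, hq, -⟩ := h1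
  rw [h2] at hq
  have hP : ∀ i ∈ PS, ∃ o ∈ OS, m o = some i := by
    intro i hi
    by_contra hno
    push Not at hno
    exact absurd ((hq i).2 ⟨hi, hno⟩) (by simp)
  choose! σ hσ hmσ using hP
  have hσinj : Set.InjOn σ PS := by
    intro i hi j hj hij
    have := hmσ i hi
    rw [hij, hmσ j hj] at this
    exact (Option.some.inj this).symm
  -- Once all persons own objects, none is left over, by counting.
  have hsurj : Set.SurjOn σ PS OS := Finset.surjOn_of_injOn_of_card_le σ hσ hσinj hcard.le
  have hO : ∀ o ∈ OS, ∃ i, m o = some i := by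
    intro o ho
    obtain ⟨i, hi, rfl⟩ := hsurj ho
    exact ⟨i, hmσ i hi⟩
  choose! μ hμ using hO
  refine ⟨p, μ, ⟨hl.nodup, hl.mem, fun e he => ?_⟩, fun o ho => hinv.mem o ho _ (hμ o ho),
    fun o ho o' ho' h => ?_, fun o ho o' ho' => hinv.slack o ho _ (hμ o ho) _ ho'⟩
  · have := hl.eq e he
    rw [hμ e.1 ((hl.mem _).1 (List.mem_map_of_mem he))] at this
    exact this
  · exact hinv.inj o ho o' ho' _ (hμ o ho) (h ▸ hμ o' ho')

/-- Inverting the bijection from objects to persons turns the outcome of one phase into the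
hypothesis of the next, whose ε is half as large. -/
theorem Assigned.exists_nearlyOptimal [Nonempty O] (hcard : OS.card = PS.card)
    {es : List (O × (ℕ × List P))} (h : Assigned c ε PS OS es) :
    ∃ (p : O → ℕ) (m : O → List P) (τ : P → O), Lists OS p m es ∧ NearlyOptimal c ε PS OS p τ := by
  obtain ⟨p, m, hl, hmaps, hinj, hs⟩ := h
  have hsurj : Set.SurjOn m OS PS := Finset.surjOn_of_injOn_of_card_le m hmaps hinj hcard.ge
  choose! τ hτ hτm using hsurj
  refine ⟨p, _, τ, hl, fun i hi => hτ hi, fun i hi j hj hij => ?_, fun i hi o ho => ?_⟩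
  · rw [← hτm hi, ← hτm hj, hij]
  · have := hs _ (hτ hi) _ ho
    rwa [hτm hi] at this

/-- The auction finds an assignment whose cost exceeds the optimum by at most the number of
persons. -/
theorem auction_spec [DecidableEq P] [DecidableEq O] [Nonempty P] [Nonempty O]
    {ps : List P} {os : List O} {C : ℕ} (hps : ps.Nodup) (hos : os.Nodup)
    (hlen : os.length = ps.length) (hC : ∀ i ∈ ps, ∀ o ∈ os, c i o ≤ C) :
    ∃ (p : O → ℕ) (m : O → P), Lists os.toFinset p (fun o => [m o]) (auction c ps os C) ∧
      Set.MapsTo m os.toFinset ps.toFinset ∧ Set.InjOn m os.toFinset ∧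
      ∀ τ : P → O, Set.MapsTo τ ps.toFinset os.toFinset → Set.InjOn τ ps.toFinset →
        ∑ o ∈ os.toFinset, c (m o) o ≤ ∑ i ∈ ps.toFinset, c i (τ i) + ps.length := by
  set PS := ps.toFinset with hPS
  set OS := os.toFinset with hOS
  have hPc : PS.card = ps.length := List.toFinset_card_of_nodup hps
  have hcard : OS.card = PS.card := by rw [hPc, ← hlen]; exact List.toFinset_card_of_nodup hos
  have hmem : ∀ i, i ∈ ps ↔ i ∈ PS := fun i => by simp [hPS]
  have hfold : ∀ (s : ℕ) (es : List (O × (ℕ × List P))) (p : O → ℕ) (m : O → List P) (τ : P → O),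
      Lists OS p m es → NearlyOptimal c (2 * 2 ^ s) PS OS p τ →
      Assigned c 1 PS OS (((List.range (s + 1)).reverse.map (2 ^ ·)).foldl
        (fun es ε => auctionPhase c ps ε es) es) := by
    intro s
    induction s with
    | zero => exact fun es p m τ hl hτ => assigned_auctionPhase one_pos hcard hps hmem hl hτ
    | succ s ih =>
      intro es p m τ hl hτ
      obtain ⟨p', m', τ', hl', hτ'⟩ := (assigned_auctionPhase (by positivity) hcard hps hmem hl
        hτ).exists_nearlyOptimal hcard
      rw [List.range_succ, List.reverse_append, List.reverse_singleton, List.singleton_append,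
        List.map_cons, List.foldl_cons]
      exact ih _ p' m' τ' hl' (by rwa [pow_succ'] at hτ')
  obtain ⟨τ₀, hτ₀, hinj₀⟩ : ∃ τ : P → O, Set.MapsTo τ PS OS ∧ Set.InjOn τ PS := by
    obtain ⟨τ, h⟩ := PS.finite_toSet.exists_bijOn_of_encard_eq (t := (OS : Set O)) (by
      rw [Set.encard_coe_eq_coe_finsetCard, Set.encard_coe_eq_coe_finsetCard, hcard])
    exact ⟨τ, h.mapsTo, h.injOn⟩
  obtain ⟨p, m, hl, hmaps, hinj, hs⟩ := hfold (Nat.size C) (os.map fun o => (o, 0, []))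
    (fun _ => 0) (fun _ => []) τ₀
    ⟨by simpa [Function.comp_def] using hos, by simp [hOS], by simp⟩
    -- At prices 0 any assignment is good enough for the first phase, since all costs are at most C
    -- < 2 ^ `Nat.size C`.
    ⟨hτ₀, hinj₀, fun i hi o ho => by
      have h1 := hC i ((hmem i).2 hi) (τ₀ i) (by simpa [hOS] using hτ₀ hi)
      have h2 := Nat.lt_size_self C
      omega⟩
  refine ⟨p, m, hl, hmaps, hinj, fun τ hτ hτi => ?_⟩
  have hsurj : Set.SurjOn m OS PS := Finset.surjOn_of_injOn_of_card_le m hmaps hinj hcard.ge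
  have hτs : Set.SurjOn τ PS OS := Finset.surjOn_of_injOn_of_card_le τ hτ hτi hcard.le
  -- Each owner compares the object o with the one that τ offers. Both sides sum the prices over all
  -- objects, so the prices cancel and an error of 1 per person remains.
  have h1 : ∑ o ∈ OS, (c (m o) o + p o) ≤ ∑ o ∈ OS, (c (m o) (τ (m o)) + p (τ (m o)) + 1) :=
    Finset.sum_le_sum fun o ho => hs o ho _ (hτ (hmaps ho))
  have h2 : ∑ o ∈ OS, (c (m o) (τ (m o)) + p (τ (m o)) + 1) =
      ∑ i ∈ PS, (c i (τ i) + p (τ i) + 1) :=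
    Finset.sum_nbij m hmaps hinj hsurj fun _ _ => rfl
  have h3 : ∑ i ∈ PS, p (τ i) = ∑ o ∈ OS, p o :=
    Finset.sum_nbij τ hτ hτi hτs fun _ _ => rfl
  rw [h2] at h1
  simp only [Finset.sum_add_distrib, h3, Finset.sum_const, smul_eq_mul, mul_one, hPc] at h1
  omega

end AuctionSpec

/-! ### The algorithm for soft repairing -/

section Algorithm
variable {k : ℕ} {α : Type} [Enc α]

theorem PolyTime.getD {l : α → List ℕ} (hl : PolyTime l) (i : ℕ) :
    PolyTime fun a => (l a).getD i 0 := by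
  induction i generalizing l with
  | zero =>
    have : PolyTime fun a => SoftRepair.listCase (l a) 0 fun n _ => n :=
      .listCase hl (by fun_prop) (by fun_prop)
    convert this using 2 with a
    cases l a <;> rfl
  | succ i ih =>
    have : PolyTime fun a => SoftRepair.listCase (l a) [] fun _ t => t :=
      .listCase hl (by fun_prop) (by fun_prop)
    convert ih this using 2 with a
    cases l a <;> simp [SoftRepair.listCase]

theorem PolyTime.fact_apply {f : α → Fact k} (hf : PolyTime f) (i : Fin k) :
    PolyTime fun a => f a i := by
  have he : ∀ f : Fact k, enc f = enc (List.ofFn f) := fun f => by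
    simp [enc, encodeFact, Function.comp_def, List.map_ofFn]
  have h : PolyTime fun f : Fact k => List.ofFn f :=
    .of_op .skip he (PolyBounded.esize.mono fun f => by rw [SoftRepair.esize, ← he]; rfl)
  convert (h.comp hf).getD i using 2 with a
  simp [List.getD]

-- The schema is fixed, so the program may contain one comparison for each attribute in X.
@[fun_prop]
theorem PolyTime.decide_agree {f g : α → Fact k} (X : Finset (Fin k)) (hf : PolyTime f)
    (hg : PolyTime g) : PolyTime fun a => decide (Agree X (f a) (g a)) := by
  induction X using Finset.induction_on with
  | empty => simpa [Agree] using PolyTime.const true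
  | insert i X _ ih =>
    have h1 := hf.fact_apply i
    have h2 := hg.fact_apply i
    have : PolyTime fun a => decide (f a i = g a i) && decide (Agree X (f a) (g a)) := by fun_prop
    convert this using 2 with a
    rw [Bool.eq_iff_iff]
    simp only [decide_eq_true_eq, Bool.and_eq_true]
    simp [Agree]

@[fun_prop]
theorem PolyTime.num {w : α → Weight} (hw : PolyTime w) : PolyTime fun a => (w a).num := by
  have h : PolyTime fun w : Weight => (w.num, w.den) := .of_op .skip (fun _ => rfl) .esize
  exact (h.comp hw).fst

@[fun_prop]
theorem PolyTime.den {w : α → Weight} (hw : PolyTime w) : PolyTime fun a => (w a).den := by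
  have h : PolyTime fun w : Weight => (w.num, w.den) := .of_op .skip (fun _ => rfl) .esize
  exact (h.comp hw).snd

/-- Inputs of soft repairing for two FDs. -/
structure Input (k : ℕ) where
  wX : Weight
  wY : Weight
  facts : List (Fact k × Weight)

instance : Enc (Input k) := ⟨fun I => enc ([I.wX, I.wY], I.facts)⟩

namespace Input

/-- The facts of the database. -/
def db (I : Input k) : List (Fact k) := I.facts.map fun x => x.1

/-- A factor that makes the granularity of costs exceed the error of the auction. -/
def scale (I : Input k) : ℕ := 2 * I.facts.length + 1

/-- The weight of the first FD, multiplied by the common denominator. -/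
def costX (I : Input k) : ℕ :=
  I.scale * (I.wX.num * I.wY.den * (I.facts.map fun x => x.2.den).prod)

/-- The weight of the second FD, multiplied by the common denominator. -/
def costY (I : Input k) : ℕ :=
  I.scale * (I.wX.den * I.wY.num * (I.facts.map fun x => x.2.den).prod)

/-- The weight of the fact `f`, multiplied by the common denominator. -/
def weight (I : Input k) (f : Fact k) : ℕ :=
  I.scale * (I.wX.den * I.wY.den * (I.facts.map fun x =>
    bif decide (Agree Finset.univ x.1 f) then x.2.num else x.2.den).prod)

/-- The position of `f` in the database. -/
def index (I : Input k) (f : Fact k) : ℕ :=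
  I.db.foldr (fun g n => bif decide (Agree Finset.univ g f) then 0 else n + 1) 0

/-- The number of earlier facts in the database that agree with `f` on `X`. -/
def rank (X : Finset (Fin k)) (I : Input k) (f : Fact k) : ℕ :=
  (I.db.filter fun g => decide (Agree X g f) && decide (I.index g < I.index f)).length

/-- A number that exceeds all costs. -/
def big (X Y : Finset (Fin k)) (I : Input k) : ℕ :=
  I.scale * (1 + (I.db.map fun f =>
    I.weight f + (I.costX * I.rank X f + I.costY * I.rank Y f)).sum)

/-- The cost of assigning the person `i` to the object `o`. -/
def assignCost (X Y : Finset (Fin k)) (I : Input k) (i o : Bool × Fact k) : ℕ :=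
  bif i.1 then
    bif o.1 then bif decide (Agree Finset.univ i.2 o.2) then I.weight o.2 else I.big X Y
    else bif decide (Agree Y i.2 o.2) then I.costY * I.rank Y o.2 else I.big X Y
  else
    bif o.1 then bif decide (Agree X i.2 o.2) then I.costX * I.rank X i.2 else I.big X Y
    else 0

/-- The persons, and likewise the objects, of the assignment problem. -/
def nodes (I : Input k) : List (Bool × Fact k) :=
  I.db.map (fun f => (false, f)) ++ I.db.map (fun f => (true, f))

/-- An optimal subset of the database: the facts `f` for which the object `(true, f)` is assigned
to a person of the form `(false, g)`. -/
def solve (X Y : Finset (Fin k)) (I : Input k) : List (Fact k) :=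
  ((auction (I.assignCost X Y) I.nodes I.nodes (I.big X Y)).filter fun e =>
    e.1.1 && listCase e.2.2 false fun i _ => !i.1).map fun e => e.1.2

end Input

/-! ### Running time of the reduction -/

theorem PolyTime.input : PolyTime fun I : Input k => ([I.wX, I.wY], I.facts) :=
  .of_op .skip (fun _ => rfl) .esize

@[fun_prop]
theorem PolyTime.input_facts {I : α → Input k} (hI : PolyTime I) :
    PolyTime fun a => (I a).facts := (PolyTime.input.comp hI).snd

@[fun_prop]
theorem PolyTime.input_wX {I : α → Input k} (hI : PolyTime I) : PolyTime fun a => (I a).wX :=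
  -- The default weight never occurs, because the encoded list has exactly two weights.
  PolyTime.listCase (z := fun _ => ⟨0, 1, one_pos⟩) (s := fun _ w _ => w)
    (PolyTime.input.comp hI).fst (by fun_prop) (by fun_prop)

@[fun_prop]
theorem PolyTime.input_wY {I : α → Input k} (hI : PolyTime I) : PolyTime fun a => (I a).wY :=
  PolyTime.listCase (z := fun _ => ⟨0, 1, one_pos⟩) (s := fun _ w _ => w)
    (PolyTime.listCase (z := fun _ => []) (s := fun _ _ t => t)
      (PolyTime.input.comp hI).fst (by fun_prop) (by fun_prop)) (by fun_prop) (by fun_prop)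

@[fun_prop]
theorem PolyTime.db {I : α → Input k} (hI : PolyTime I) : PolyTime fun a => (I a).db :=
  .map (by fun_prop) (by fun_prop)

@[fun_prop]
theorem PolyTime.scale {I : α → Input k} (hI : PolyTime I) : PolyTime fun a => (I a).scale := by
  unfold Input.scale; fun_prop

@[fun_prop]
theorem PolyTime.input_dens {I : α → Input k} (hI : PolyTime I) :
    PolyTime fun a => ((I a).facts.map fun x => x.2.den).prod :=
  .prod (.map (by fun_prop) (by fun_prop))

@[fun_prop]
theorem PolyTime.costX {I : α → Input k} (hI : PolyTime I) : PolyTime fun a => (I a).costX := by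
  unfold Input.costX; fun_prop

@[fun_prop]
theorem PolyTime.costY {I : α → Input k} (hI : PolyTime I) : PolyTime fun a => (I a).costY := by
  unfold Input.costY; fun_prop

@[fun_prop]
theorem PolyTime.weight {I : α → Input k} {f : α → Fact k} (hI : PolyTime I) (hf : PolyTime f) :
    PolyTime fun a => (I a).weight (f a) := by
  refine .mul (by fun_prop) (.mul (by fun_prop) (.prod (.map ?_ (by fun_prop))))
  exact .cond (by fun_prop) (by fun_prop) (by fun_prop)

@[fun_prop]
theorem PolyTime.index {I : α → Input k} {f : α → Fact k} (hI : PolyTime I) (hf : PolyTime f) :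
    PolyTime fun a => (I a).index (f a) := by
  refine PolyTime.foldr_of_growth (G := fun _ => 2) (by fun_prop) (by fun_prop) (by fun_prop)
    (.const 2) fun a n g _ => ?_
  have := size_add_le n 1
  have h1 : Nat.size 0 = 0 := rfl
  simp only [Bool.cond_decide, esize_nat, Nat.size_one] at this ⊢
  split_ifs <;> omega

@[fun_prop]
theorem PolyTime.rank (X : Finset (Fin k)) {I : α → Input k} {f : α → Fact k} (hI : PolyTime I)
    (hf : PolyTime f) : PolyTime fun a => (I a).rank X (f a) :=
  .length (.filter (by fun_prop) (by fun_prop))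

@[fun_prop]
theorem PolyTime.big (X Y : Finset (Fin k)) {I : α → Input k} (hI : PolyTime I) :
    PolyTime fun a => (I a).big X Y :=
  .mul (by fun_prop) (.add (by fun_prop) (.sum (.map (by fun_prop) (by fun_prop))))

theorem PolyTime.nodes : PolyTime (Input.nodes (k := k)) :=
  .append (.map (by fun_prop) (by fun_prop)) (.map (by fun_prop) (by fun_prop))

theorem PolyTime.assignCost (X Y : Finset (Fin k)) :
    PolyTime fun x : Input k × ((Bool × Fact k) × (Bool × Fact k)) =>
      x.1.assignCost X Y x.2.1 x.2.2 := by
  refine .cond (by fun_prop) (.cond (by fun_prop) (.cond ?_ ?_ ?_) (.cond ?_ (.mul ?_ ?_) ?_))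
    (.cond (by fun_prop) (.cond ?_ (.mul ?_ ?_) ?_) ?_) <;> fun_prop

theorem PolyTime.solve (X Y : Finset (Fin k)) : PolyTime (Input.solve X Y) := by
  have hb : PolyTime fun I : Input k => I.big X Y := by fun_prop
  have ha := PolyTime.auction (PolyTime.assignCost X Y) PolyTime.nodes PolyTime.nodes hb
  unfold Input.solve
  refine .map (by fun_prop) (.filter ?_ ha)
  refine .and (by fun_prop) ?_
  exact .listCase (by fun_prop) (by fun_prop) (by fun_prop)

end Algorithm

/-! ### Counting violations -/

section Counting
variable {k : ℕ}

theorem Agree.symm {X : Finset (Fin k)} {f g : Fact k} (h : Agree X f g) : Agree X g f :=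
  fun a ha => (h a ha).symm

theorem Agree.trans {X : Finset (Fin k)} {f g h : Fact k} (h₁ : Agree X f g) (h₂ : Agree X g h) :
    Agree X f h := fun a ha => (h₁ a ha).trans (h₂ a ha)

theorem agree_refl (X : Finset (Fin k)) (f : Fact k) : Agree X f f := fun _ _ => rfl

theorem agree_univ_iff {f g : Fact k} : Agree Finset.univ f g ↔ f = g :=
  ⟨fun h => funext fun a => h a (Finset.mem_univ a), fun h => h ▸ agree_refl _ _⟩

/-- The number of facts in `E` that agree with `g` on `X` and precede it with respect to `ρ`. -/
def countBefore (X : Finset (Fin k)) (ρ : Fact k → ℕ) (E : Finset (Fact k)) (g : Fact k) : ℕ :=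
  (E.filter fun h => Agree X h g ∧ ρ h < ρ g).card

/-- `ρ` separates the facts of `E` that agree on `X`. -/
def Separates (X : Finset (Fin k)) (ρ : Fact k → ℕ) (E : Finset (Fact k)) : Prop :=
  ∀ f ∈ E, ∀ g ∈ E, Agree X f g → ρ f = ρ g → f = g

variable {X : Finset (Fin k)} {ρ : Fact k → ℕ} {D E : Finset (Fact k)}

/-- Every violating pair is counted once, at its later member. Conversely, distinct facts that agree
on the left-hand side must differ on the right-hand side, as the two sides cover all attributes. -/
theorem card_vio {φ : FD k} (hφ : φ.lhs ∪ φ.rhs = Finset.univ) (hρ : Separates φ.lhs ρ E) :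
    (vio E φ).card = ∑ g ∈ E, countBefore φ.lhs ρ E g := by
  simp only [countBefore]
  rw [← Finset.card_sigma]
  symm
  refine Finset.card_nbij (fun x => {x.2, x.1}) ?_ ?_ ?_
  · rintro ⟨g, h⟩ hx
    simp only [Finset.mem_coe, Finset.mem_sigma, Finset.mem_filter] at hx
    obtain ⟨hg, hh, ha, hlt⟩ := hx
    have hne : h ≠ g := fun e => by rw [e] at hlt; exact lt_irrefl _ hlt
    simp only [vio, Finset.mem_coe, Finset.mem_filter, Finset.mem_powersetCard]
    refine ⟨⟨?_, Finset.card_pair hne⟩, h, by simp, g, by simp, ha, fun hr => hne ?_⟩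
    · simp [Finset.insert_subset_iff, hg, hh]
    · refine agree_univ_iff.1 fun a ha' => ?_
      rw [← hφ, Finset.mem_union] at ha'
      exact ha'.elim (ha a) (hr a)
  · rintro ⟨g, h⟩ hx ⟨g', h'⟩ hx' heq
    simp only [Finset.mem_coe, Finset.mem_sigma, Finset.mem_filter] at hx hx' heq
    have h1 : h ∈ ({h', g'} : Finset (Fact k)) := heq ▸ by simp
    have h2 : g ∈ ({h', g'} : Finset (Fact k)) := heq ▸ by simp
    have h3 : ({h, g} : Finset (Fact k)).card = ({h', g'} : Finset (Fact k)).card := by rw [heq]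
    simp only [Finset.mem_insert, Finset.mem_singleton] at h1 h2
    have hlt := hx.2.2.2
    have hlt' := hx'.2.2.2
    rcases h1 with rfl | rfl <;> rcases h2 with rfl | rfl
    · exact absurd hlt (lt_irrefl _)
    · rfl
    · exact absurd hlt (lt_asymm hlt')
    · exact absurd hlt (lt_irrefl _)
  · intro p hp
    simp only [vio, Finset.mem_coe, Finset.mem_filter, Finset.mem_powersetCard] at hp
    obtain ⟨⟨hpE, hp2⟩, f, hf, g, hg, ha, hna⟩ := hp
    have hne : f ≠ g := fun e => hna (e ▸ agree_refl _ _)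
    have hpeq : p = {f, g} := by
      symm
      apply Finset.eq_of_subset_of_card_le
      · simp [Finset.insert_subset_iff, hf, hg]
      · rw [hp2, Finset.card_pair hne]
    rcases lt_trichotomy (ρ f) (ρ g) with hlt | he | hlt
    · refine ⟨⟨g, f⟩, ?_, hpeq.symm⟩
      simp [hpE hf, hpE hg, ha, hlt]
    · exact absurd (hρ f (hpE hf) g (hpE hg) ha he) hne
    · refine ⟨⟨f, g⟩, ?_, by rw [hpeq, Finset.pair_comm]⟩
      simp [hpE hf, hpE hg, ha.symm, hlt]

/-- The predecessors of g in its class have different values of ρ, all below `ρ g`. -/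
theorem countBefore_le (hρ : Separates X ρ E) (g : Fact k) : countBefore X ρ E g ≤ ρ g := by
  rw [countBefore, ← Finset.card_range (ρ g)]
  refine Finset.card_le_card_of_injOn ρ (fun h hh => ?_) fun h hh h' hh' heq => ?_
  · simpa using (Finset.mem_filter.1 hh).2.2
  · simp only [Finset.coe_filter, Set.mem_ofPred_eq] at hh hh'
    exact hρ _ hh.1 _ hh'.1 (hh.2.1.trans hh'.2.1.symm) heq

/-- Assigning to the facts of `E` different facts with which they agree costs at least the
number of violations. -/
theorem card_vio_le {φ : FD k} (hφ : φ.lhs ∪ φ.rhs = Finset.univ) {r : Fact k → ℕ}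
    (hr : Separates φ.lhs r D) {ι : Fact k → Fact k} (hι : Set.InjOn ι E)
    (hD : ∀ g ∈ E, ι g ∈ D) (ha : ∀ g ∈ E, Agree φ.lhs (ι g) g) :
    (vio E φ).card ≤ ∑ g ∈ E, r (ι g) := by
  -- The facts of E are ordered by the slots that they take. A fact with s predecessors in its class
  -- then has a slot of rank at least s.
  have hs : Separates φ.lhs (fun g => r (ι g)) E := fun f hf g hg hfg h =>
    hι hf hg (hr _ (hD f hf) _ (hD g hg) (((ha f hf).trans hfg).trans (ha g hg).symm) h)
  rw [card_vio hφ hs]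
  exact Finset.sum_le_sum fun g _ => countBefore_le hs g

theorem countBefore_lt {f g : Fact k} (hf : f ∈ D) (h : Agree X f g) (hlt : ρ f < ρ g) :
    countBefore X ρ D f < countBefore X ρ D g := by
  refine Finset.card_lt_card ((Finset.ssubset_iff_of_subset fun h' hh' => ?_).2 ⟨f, ?_, ?_⟩)
  · simp only [Finset.mem_filter] at hh' ⊢
    exact ⟨hh'.1, hh'.2.1.trans h, hh'.2.2.trans hlt⟩
  · simp [hf, h, hlt]
  · simp

/-- Within a class, ranks increase strictly with ρ. -/
theorem Separates.countBefore (hρ : Separates X ρ D) :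
    Separates X (countBefore X ρ D) D := by
  intro f hf g hg ha he
  rcases lt_trichotomy (ρ f) (ρ g) with hlt | h | hlt
  · exact absurd he (countBefore_lt hf ha hlt).ne
  · exact hρ f hf g hg ha h
  · exact absurd he (countBefore_lt hg ha.symm hlt).ne'

theorem countBefore_lt_card {g : Fact k} (hg : g ∈ D) :
    SoftRepair.countBefore X ρ D g < (D.filter fun h => Agree X h g).card := by
  refine Finset.card_lt_card ((Finset.ssubset_iff_of_subset fun h hh => ?_).2 ⟨g, ?_, ?_⟩)
  · simp only [Finset.mem_filter] at hh ⊢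
    exact ⟨hh.1, hh.2.1⟩
  · simp [hg, agree_refl]
  · simp

/-- The number of violations is attained by an assignment. -/
theorem exists_sum_eq_card_vio {φ : FD k} (hφ : φ.lhs ∪ φ.rhs = Finset.univ)
    (hρ : Separates φ.lhs ρ D) (hE : E ⊆ D) :
    ∃ ι : Fact k → Fact k, Set.InjOn ι E ∧ (∀ g ∈ E, ι g ∈ D) ∧
      (∀ g ∈ E, Agree φ.lhs (ι g) g) ∧
      ∑ g ∈ E, countBefore φ.lhs ρ D (ι g) = (vio E φ).card := by
  have hρE : Separates φ.lhs ρ E := fun f hf g hg => hρ f (hE hf) g (hE hg)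
  have key : ∀ g ∈ E, ∃ f ∈ D, Agree φ.lhs f g ∧
      countBefore φ.lhs ρ D f = countBefore φ.lhs ρ E g := by
    intro g hg
    set K := D.filter fun h => Agree φ.lhs h g with hK
    have hcl : ∀ f ∈ K, (D.filter fun h => Agree φ.lhs h f) = K := by
      intro f hf
      ext h
      have hfg := (Finset.mem_filter.1 hf).2
      simp only [hK, Finset.mem_filter]
      exact and_congr_right fun _ => ⟨fun h => h.trans hfg, fun h => h.trans hfg.symm⟩
    -- The ranks in the class K are distinct and below its cardinality, hence take all these values.
    -- So the fact of rank s in the E-part of the class can be sent to the fact of rank s in K.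
    have hsurj : Set.SurjOn (countBefore φ.lhs ρ D) K (Finset.range K.card) := by
      apply Finset.surjOn_of_injOn_of_card_le
      · intro f hf
        have := countBefore_lt_card (X := φ.lhs) (ρ := ρ) (Finset.mem_filter.1 hf).1
        rw [hcl f hf] at this
        simpa using this
      · intro f hf f' hf' he
        have h1 := Finset.mem_filter.1 hf
        have h2 := Finset.mem_filter.1 hf'
        exact hρ.countBefore f h1.1 f' h2.1 (h1.2.trans h2.2.symm) he
      · simp
    have hlt : countBefore φ.lhs ρ E g < K.card :=
      (countBefore_lt_card hg).trans_le (Finset.card_le_card (Finset.filter_subset_filter _ hE))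
    obtain ⟨f, hf, hfe⟩ := hsurj (by simpa using hlt)
    exact ⟨f, (Finset.mem_filter.1 hf).1, (Finset.mem_filter.1 hf).2, hfe⟩
  choose! ι hD ha hr using key
  refine ⟨ι, fun f hf g hg he => ?_, hD, ha, ?_⟩
  · refine hρE.countBefore f hf g hg ?_ ?_
    · exact (ha f hf).symm.trans (he ▸ ha g hg)
    · rw [← hr f hf, ← hr g hg, he]
  · rw [card_vio hφ hρE]
    exact Finset.sum_congr rfl hr

end Counting

/-! ### The assignment problem represents soft repairing -/

section Reduction
variable {k : ℕ} {φ ψ : FD k} {I : Input k}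

namespace Input

/-- The cost of `E`, multiplied by the common denominator. -/
def intCost (φ ψ : FD k) (I : Input k) (E : Finset (Fact k)) : ℕ :=
  ∑ f ∈ I.db.toFinset \ E, I.weight f +
    (I.costX * (vio E φ).card + I.costY * (vio E ψ).card)

theorem index_eq (I : Input k) (f : Fact k) : I.index f = I.db.idxOf f := by
  rw [index]
  induction I.db with
  | nil => rfl
  | cons g l ih =>
    rw [List.foldr_cons, ih, List.idxOf_cons, Bool.cond_decide, Bool.cond_eq_ite]
    simp [agree_univ_iff]

theorem separates_index (X : Finset (Fin k)) (I : Input k) :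
    Separates X I.index I.db.toFinset := by
  intro f hf g _ _ he
  rw [index_eq, index_eq] at he
  exact (List.idxOf_inj (List.mem_toFinset.1 hf)).1 he

theorem rank_eq (h : I.db.Nodup) (X : Finset (Fin k)) (f : Fact k) :
    I.rank X f = countBefore X I.index I.db.toFinset f := by
  rw [rank, countBefore, ← List.toFinset_card_of_nodup (h.filter _)]
  congr 1
  ext g
  simp

theorem separates_rank (h : I.db.Nodup) (X : Finset (Fin k)) :
    Separates X (I.rank X) I.db.toFinset := by
  have := (separates_index X I).countBefore
  rwa [show countBefore X I.index I.db.toFinset = I.rank X from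
    funext fun f => (rank_eq h X f).symm] at this

theorem mem_nodes {x : Bool × Fact k} : x ∈ I.nodes ↔ x.2 ∈ I.db := by
  obtain ⟨b, f⟩ := x
  cases b <;> simp [nodes]

theorem nodup_nodes (h : I.db.Nodup) : I.nodes.Nodup := by
  refine List.Nodup.append (h.map (Prod.mk_right_injective _)) (h.map (Prod.mk_right_injective _))
    ?_
  intro x hx hx'
  simp only [List.mem_map] at hx hx'
  obtain ⟨f, -, rfl⟩ := hx
  obtain ⟨g, -, h⟩ := hx'
  simp at h

/-- The auction errs by at most the number of nodes, which is thus less than the granularity of the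
costs. -/
theorem scale_eq (I : Input k) : I.scale = I.nodes.length + 1 := by
  simp [scale, nodes, db]
  ring

theorem sum_nodes (I : Input k) (F : Bool × Fact k → ℕ) :
    ∑ x ∈ I.nodes.toFinset, F x =
      ∑ f ∈ I.db.toFinset, F (true, f) + ∑ f ∈ I.db.toFinset, F (false, f) := by
  have : I.nodes.toFinset = Finset.univ ×ˢ I.db.toFinset := by
    ext x
    simp [mem_nodes]
  rw [this, Finset.sum_product, Fintype.sum_bool]

theorem term_le_big (X Y : Finset (Fin k)) {f : Fact k} (hf : f ∈ I.db) :
    I.weight f + (I.costX * I.rank X f + I.costY * I.rank Y f) ≤ I.big X Y := by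
  have h1 := List.le_sum_of_mem (List.mem_map_of_mem (f := fun f =>
    I.weight f + (I.costX * I.rank X f + I.costY * I.rank Y f)) hf)
  have h2 : 1 ≤ I.scale := by simp [scale]
  exact (h1.trans (Nat.le_add_left _ 1)).trans (Nat.le_mul_of_pos_left _ h2)

/-- Deleting all facts is cheaper than a single forbidden pair. The summand 1 in `big` makes the
inequality strict. -/
theorem sum_weight_lt_big (h : I.db.Nodup) (X Y : Finset (Fin k)) :
    ∑ f ∈ I.db.toFinset, I.weight f < I.big X Y := by
  have h1 : ∑ f ∈ I.db.toFinset, I.weight f ≤ ∑ f ∈ I.db.toFinset,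
      (I.weight f + (I.costX * I.rank X f + I.costY * I.rank Y f)) :=
    Finset.sum_le_sum fun f _ => Nat.le_add_right _ _
  have h2 : 1 ≤ I.scale := by simp [scale]
  refine h1.trans_lt ?_
  rw [List.sum_toFinset _ h]
  exact (Nat.lt_add_of_pos_left Nat.one_pos).trans_le (Nat.le_mul_of_pos_left _ h2)

theorem assignCost_le_big (X Y : Finset (Fin k)) {i o : Bool × Fact k} (hi : i ∈ I.nodes)
    (ho : o ∈ I.nodes) : I.assignCost X Y i o ≤ I.big X Y := by
  have h1 := term_le_big X Y (mem_nodes.1 hi)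
  have h2 := term_le_big X Y (mem_nodes.1 ho)
  simp only [assignCost, Bool.cond_eq_ite]
  split_ifs <;> omega

theorem scale_dvd_assignCost (X Y : Finset (Fin k)) (i o : Bool × Fact k) :
    I.scale ∣ I.assignCost X Y i o := by
  have h1 : I.scale ∣ I.big X Y := Dvd.intro _ rfl
  have h2 : I.scale ∣ I.costX := Dvd.intro _ rfl
  have h3 : I.scale ∣ I.costY := Dvd.intro _ rfl
  have h4 : ∀ f, I.scale ∣ I.weight f := fun f => Dvd.intro _ rfl
  simp only [assignCost, Bool.cond_eq_ite]
  split_ifs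
  exacts [h4 _, h1, h3.mul_right _, h1, h2.mul_right _, h1, dvd_zero _]

/-- The facts `f` for which the object `(true, f)` is assigned to a person `(false, g)`. -/
def chosen (I : Input k) (m : Bool × Fact k → Bool × Fact k) : Finset (Fact k) :=
  I.db.toFinset.filter fun f => (m (true, f)).1 = false

/-- An assignment without forbidden pairs costs at least as much as the subset that it
represents. -/
theorem intCost_chosen_le (h : I.db.Nodup) (hφ : φ.lhs ∪ φ.rhs = Finset.univ)
    (hψ : ψ.lhs ∪ ψ.rhs = Finset.univ) {m : Bool × Fact k → Bool × Fact k}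
    (hm : Set.MapsTo m I.nodes.toFinset I.nodes.toFinset) (hinj : Set.InjOn m I.nodes.toFinset)
    (hlt : ∑ o ∈ I.nodes.toFinset, I.assignCost φ.lhs ψ.lhs (m o) o < I.big φ.lhs ψ.lhs) :
    I.intCost φ ψ (I.chosen m) ≤
      ∑ o ∈ I.nodes.toFinset, I.assignCost φ.lhs ψ.lhs (m o) o := by
  set D := I.db.toFinset with hD
  set E := I.chosen m with hE
  have hED : E ⊆ D := Finset.filter_subset _ _
  have hmem : ∀ b f, (b, f) ∈ I.nodes.toFinset ↔ f ∈ D := fun b f => by simp [mem_nodes, hD]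
  have hm2 : ∀ b, ∀ f ∈ D, (m (b, f)).2 ∈ D := fun b f hf => by
    have := hm ((hmem b f).2 hf)
    rw [Finset.mem_coe, ← Prod.mk.eta (p := m (b, f)), hmem] at this
    exact this
  -- A single forbidden pair would already cost `big`.
  have hallow : ∀ b, ∀ f ∈ D, I.assignCost φ.lhs ψ.lhs (m (b, f)) (b, f) ≠ I.big φ.lhs ψ.lhs := by
    intro b f hf he
    have := Finset.single_le_sum (f := fun o => I.assignCost φ.lhs ψ.lhs (m o) o)
      (fun _ _ => Nat.zero_le _) ((hmem b f).2 hf)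
    omega
  have hEf : ∀ f ∈ E, (m (true, f)).1 = false := fun f hf => (Finset.mem_filter.1 hf).2
  have hT : ∀ f ∈ D \ E, I.assignCost φ.lhs ψ.lhs (m (true, f)) (true, f) = I.weight f := by
    intro f hf
    obtain ⟨hfD, hfE⟩ := Finset.mem_sdiff.1 hf
    have h1 : (m (true, f)).1 = true := by
      rw [← Bool.not_eq_false]
      exact fun h' => hfE (Finset.mem_filter.2 ⟨hfD, h'⟩)
    have h2 := hallow true f hfD
    simp only [assignCost, h1, cond_true, Bool.cond_decide] at h2 ⊢
    split_ifs at h2 ⊢ <;> first | rfl | exact absurd rfl h2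
  have hX : ∀ f ∈ E, Agree φ.lhs (m (true, f)).2 f ∧
      I.assignCost φ.lhs ψ.lhs (m (true, f)) (true, f) =
        I.costX * I.rank φ.lhs (m (true, f)).2 := by
    intro f hf
    have h2 := hallow true f (hED hf)
    simp only [assignCost, hEf f hf, cond_true, cond_false, Bool.cond_decide] at h2 ⊢
    split_ifs at h2 ⊢ with h3
    · exact ⟨h3, rfl⟩
    · exact absurd rfl h2
  have hιinj : Set.InjOn (fun f => (m (true, f)).2) E := by
    intro f hf g hg he
    have : m (true, f) = m (true, g) := Prod.ext ((hEf f hf).trans (hEf g hg).symm) he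
    exact (Prod.mk.inj (hinj ((hmem _ _).2 (hED hf)) ((hmem _ _).2 (hED hg)) this)).2
  have hsurj : Set.SurjOn m I.nodes.toFinset I.nodes.toFinset :=
    Finset.surjOn_of_injOn_of_card_le m hm hinj le_rfl
  have hY : ∀ f ∈ E, ∃ g ∈ D, m (false, g) = (true, f) ∧ Agree ψ.lhs g f ∧
      I.assignCost φ.lhs ψ.lhs (m (false, g)) (false, g) = I.costY * I.rank ψ.lhs g := by
    intro f hf
    -- The person `(true, f)` must own some object. It does not own `(true, f)`, because f is
    -- chosen, and the other objects `(true, g)` are forbidden, so it owns a slot.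
    obtain ⟨⟨b, g⟩, hg, hgf⟩ := hsurj ((hmem true f).2 (hED hf))
    have hgD := (hmem b g).1 hg
    have h2 := hallow b g hgD
    cases b
    · refine ⟨g, hgD, hgf, ?_⟩
      simp only [assignCost, hgf, cond_true, cond_false, Bool.cond_decide] at h2 ⊢
      split_ifs at h2 ⊢ with h3
      · exact ⟨h3.symm, rfl⟩
      · exact absurd rfl h2
    · exfalso
      simp only [assignCost, hgf, cond_true, Bool.cond_decide] at h2
      split_ifs at h2 with h3
      · obtain rfl := agree_univ_iff.1 h3
        have := hEf f hf
        rw [hgf] at this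
        exact absurd this (by simp)
      · exact absurd rfl h2
  choose! κ hκD hκ hκa hκc using hY
  have hκinj : Set.InjOn κ E := by
    intro f hf g hg he
    have := hκ f hf
    rw [he, hκ g hg] at this
    exact (Prod.mk.inj this).2.symm
  have h1 := card_vio_le hφ (separates_rank h φ.lhs) hιinj (fun g hg => hm2 _ g (hED hg))
    fun g hg => (hX g hg).1
  have h2 := card_vio_le hψ (separates_rank h ψ.lhs) hκinj hκD hκa
  -- Different chosen facts own different slots; the costs of the remaining objects `(false, f)` are
  -- dropped.
  have h3 : ∑ f ∈ E, I.costY * I.rank ψ.lhs (κ f) ≤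
      ∑ f ∈ D, I.assignCost φ.lhs ψ.lhs (m (false, f)) (false, f) := by
    rw [← Finset.sum_congr rfl hκc, ← Finset.sum_image (g := κ) (f := fun f =>
      I.assignCost φ.lhs ψ.lhs (m (false, f)) (false, f)) hκinj]
    exact Finset.sum_le_sum_of_subset (Finset.image_subset_iff.2 hκD)
  rw [sum_nodes, ← hD, ← Finset.sum_sdiff hED, Finset.sum_congr rfl hT,
    Finset.sum_congr rfl fun f hf => (hX f hf).2, ← Finset.mul_sum, intCost, ← hD]
  rw [← Finset.mul_sum] at h3
  have h4 := Nat.mul_le_mul_left I.costX h1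
  have h5 := Nat.mul_le_mul_left I.costY h2
  change ∑ f ∈ D \ E, I.weight f + _ ≤ ∑ f ∈ D \ E, I.weight f + _ + _
  omega

/-- Every subset of the database is represented by an assignment of the same cost. -/
theorem exists_assignment (h : I.db.Nodup) (hφ : φ.lhs ∪ φ.rhs = Finset.univ)
    (hψ : ψ.lhs ∪ ψ.rhs = Finset.univ) {E : Finset (Fact k)} (hED : E ⊆ I.db.toFinset) :
    ∃ τ : Bool × Fact k → Bool × Fact k,
      Set.MapsTo τ I.nodes.toFinset I.nodes.toFinset ∧ Set.InjOn τ I.nodes.toFinset ∧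
      ∑ i ∈ I.nodes.toFinset, I.assignCost φ.lhs ψ.lhs i (τ i) = I.intCost φ ψ E := by
  obtain ⟨ι, hι, hιD, hιa, hιs⟩ := exists_sum_eq_card_vio hφ (separates_index φ.lhs I) hED
  obtain ⟨κ, hκ, hκD, hκa, hκs⟩ := exists_sum_eq_card_vio hψ (separates_index ψ.lhs I) hED
  simp only [← rank_eq h] at hιs hκs
  set D := I.db.toFinset with hD
  have hmem : ∀ b f, (b, f) ∈ I.nodes.toFinset ↔ f ∈ D := fun b f => by simp [mem_nodes, hD]
  have hιs' : E.image ι ⊆ D := Finset.image_subset_iff.2 hιD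
  have hκs' : E.image κ ⊆ D := Finset.image_subset_iff.2 hκD
  -- The unused slots on the two sides are equally many, namely |D| - |E|, and are matched
  -- arbitrarily.
  obtain ⟨e, he⟩ := (D \ E.image ι).finite_toSet.exists_bijOn_of_encard_eq
    (t := ((D \ E.image κ : Finset (Fact k)) : Set (Fact k))) (by
      rw [Set.encard_coe_eq_coe_finsetCard, Set.encard_coe_eq_coe_finsetCard,
        Finset.card_sdiff_of_subset hιs', Finset.card_sdiff_of_subset hκs',
        Finset.card_image_of_injOn hι, Finset.card_image_of_injOn hκ])
  have hinv : ∀ f ∈ E.image ι, ∃ g ∈ E, ι g = f := fun f hf => Finset.mem_image.1 hf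
  choose! ι' hι'E hι' using hinv
  let τ : Bool × Fact k → Bool × Fact k := fun x =>
    if x.1 then if x.2 ∈ E then (false, κ x.2) else (true, x.2)
    else if x.2 ∈ E.image ι then (true, ι' x.2) else (false, e x.2)
  have t1 : ∀ f ∈ E, τ (true, f) = (false, κ f) := fun f hf => by simp only [τ, if_true, if_pos hf]
  have t2 : ∀ f ∉ E, τ (true, f) = (true, f) := fun f hf => by simp only [τ, if_true, if_neg hf]
  have t3 : ∀ f ∈ E.image ι, τ (false, f) = (true, ι' f) := fun f hf => by
    simp only [τ, if_pos hf, Bool.false_eq_true, if_false]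
  have t4 : ∀ f ∉ E.image ι, τ (false, f) = (false, e f) := fun f hf => by
    simp only [τ, if_neg hf, Bool.false_eq_true, if_false]
  have heD : ∀ f ∈ D, f ∉ E.image ι → e f ∈ D ∧ e f ∉ E.image κ := fun f hf hfE => by
    have := he.mapsTo (Finset.mem_coe.2 (Finset.mem_sdiff.2 ⟨hf, hfE⟩))
    exact Finset.mem_sdiff.1 (Finset.mem_coe.1 this)
  refine ⟨τ, ?_, ?_, ?_⟩
  · rintro ⟨b, f⟩ hf₀
    have hf := (hmem b f).1 hf₀
    rw [Finset.mem_coe]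
    cases b
    · by_cases hfE : f ∈ E.image ι
      · rw [t3 f hfE, hmem]; exact hED (hι'E f hfE)
      · rw [t4 f hfE, hmem]; exact (heD f hf hfE).1
    · by_cases hfE : f ∈ E
      · rw [t1 f hfE, hmem]; exact hκD f hfE
      · rw [t2 f hfE, hmem]; exact hf
  · rintro ⟨b, f⟩ hf₀ ⟨b', f'⟩ hf₀' heq
    have hf := (hmem b f).1 hf₀
    have hf' := (hmem b' f').1 hf₀'
    cases b <;> cases b'
    · by_cases hfE : f ∈ E.image ι <;> by_cases hfE' : f' ∈ E.image ι
      · rw [t3 f hfE, t3 f' hfE'] at heq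
        rw [← hι' f hfE, ← hι' f' hfE', (Prod.mk.inj heq).2]
      · rw [t3 f hfE, t4 f' hfE'] at heq; simp at heq
      · rw [t4 f hfE, t3 f' hfE'] at heq; simp at heq
      · rw [t4 f hfE, t4 f' hfE'] at heq
        rw [he.injOn (Finset.mem_coe.2 (Finset.mem_sdiff.2 ⟨hf, hfE⟩))
          (Finset.mem_coe.2 (Finset.mem_sdiff.2 ⟨hf', hfE'⟩)) (Prod.mk.inj heq).2]
    · exfalso
      by_cases hfE : f ∈ E.image ι <;> by_cases hfE' : f' ∈ E
      · rw [t3 f hfE, t1 f' hfE'] at heq; simp at heq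
      · rw [t3 f hfE, t2 f' hfE'] at heq
        exact hfE' ((Prod.mk.inj heq).2 ▸ hι'E f hfE)
      · rw [t4 f hfE, t1 f' hfE'] at heq
        exact (heD f hf hfE).2 ((Prod.mk.inj heq).2 ▸ Finset.mem_image_of_mem κ hfE')
      · rw [t4 f hfE, t2 f' hfE'] at heq; simp at heq
    · exfalso
      by_cases hfE : f' ∈ E.image ι <;> by_cases hfE' : f ∈ E
      · rw [t3 f' hfE, t1 f hfE'] at heq; simp at heq
      · rw [t3 f' hfE, t2 f hfE'] at heq
        exact hfE' ((Prod.mk.inj heq).2 ▸ hι'E f' hfE)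
      · rw [t4 f' hfE, t1 f hfE'] at heq
        exact (heD f' hf' hfE).2 ((Prod.mk.inj heq).2 ▸ Finset.mem_image_of_mem κ hfE')
      · rw [t4 f' hfE, t2 f hfE'] at heq; simp at heq
    · by_cases hfE : f ∈ E <;> by_cases hfE' : f' ∈ E
      · rw [t1 f hfE, t1 f' hfE'] at heq
        rw [hκ hfE hfE' (Prod.mk.inj heq).2]
      · rw [t1 f hfE, t2 f' hfE'] at heq; simp at heq
      · rw [t2 f hfE, t1 f' hfE'] at heq; simp at heq
      · rw [t2 f hfE, t2 f' hfE'] at heq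
        exact heq
  · have c1 : ∀ f ∈ E, I.assignCost φ.lhs ψ.lhs (true, f) (τ (true, f)) =
        I.costY * I.rank ψ.lhs (κ f) := fun f hf => by
      rw [t1 f hf]; simp [assignCost, (hκa f hf).symm]
    have c2 : ∀ f ∈ D \ E, I.assignCost φ.lhs ψ.lhs (true, f) (τ (true, f)) = I.weight f :=
      fun f hf => by rw [t2 f (Finset.mem_sdiff.1 hf).2]; simp [assignCost, agree_refl]
    have c3 : ∀ f ∈ E.image ι, I.assignCost φ.lhs ψ.lhs (false, f) (τ (false, f)) =
        I.costX * I.rank φ.lhs f := fun f hf => by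
      have := hιa _ (hι'E f hf)
      rw [hι' f hf] at this
      rw [t3 f hf]; simp [assignCost, this]
    have c4 : ∀ f ∈ D \ E.image ι, I.assignCost φ.lhs ψ.lhs (false, f) (τ (false, f)) = 0 :=
      fun f hf => by rw [t4 f (Finset.mem_sdiff.1 hf).2]; simp [assignCost]
    rw [sum_nodes, ← hD, ← Finset.sum_sdiff hED, ← Finset.sum_sdiff hιs', Finset.sum_congr rfl c1,
      Finset.sum_congr rfl c2, Finset.sum_congr rfl c3, Finset.sum_congr rfl c4,
      Finset.sum_image hι, Finset.sum_const_zero, ← Finset.mul_sum, ← Finset.mul_sum, hκs, hιs,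
      intCost, ← hD]
    ring

end Input

end Reduction

/-! ### Correctness and running time -/

section Main
variable {k : ℕ} {φ ψ : FD k}

namespace Input

theorem solve_spec {I : Input k} (h : I.db.Nodup) (hφ : φ.lhs ∪ φ.rhs = Finset.univ)
    (hψ : ψ.lhs ∪ ψ.rhs = Finset.univ) :
    (I.solve φ.lhs ψ.lhs).Nodup ∧ (I.solve φ.lhs ψ.lhs).toFinset ⊆ I.db.toFinset ∧
      ∀ E ⊆ I.db.toFinset,
        I.intCost φ ψ (I.solve φ.lhs ψ.lhs).toFinset ≤ I.intCost φ ψ E := by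
  obtain ⟨p, m, hl, hmaps, hinj, hopt⟩ := auction_spec (c := I.assignCost φ.lhs ψ.lhs)
    (C := I.big φ.lhs ψ.lhs) (nodup_nodes h) (nodup_nodes h) rfl
    fun i hi o ho => assignCost_le_big _ _ hi ho
  have hsolve : (I.solve φ.lhs ψ.lhs).toFinset = I.chosen m := by
    ext f
    simp only [solve, List.mem_toFinset, List.mem_map, List.mem_filter, Bool.and_eq_true, chosen,
      Finset.mem_filter]
    constructor
    · rintro ⟨e, ⟨he, he1, he2⟩, rfl⟩
      have h1 := hl.eq e he
      have h2 : e.2.2 = [m e.1] := congrArg (fun x => x.2.2) h1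
      have h3 : e.1 = (true, e.1.2) := Prod.ext he1 rfl
      have h4 := mem_nodes.1 (List.mem_toFinset.1 ((hl.mem e.1).1 (List.mem_map_of_mem he)))
      rw [h2] at he2
      refine ⟨h4, ?_⟩
      rw [← h3]
      simpa [listCase] using he2
    · rintro ⟨hf, hmf⟩
      obtain ⟨e, he, hef⟩ := List.mem_map.1 ((hl.mem (true, f)).2 (by simpa [mem_nodes] using hf))
      have h1 := hl.eq e he
      have h2 : e.2.2 = [m e.1] := congrArg (fun x => x.2.2) h1
      refine ⟨e, ⟨he, by rw [hef], ?_⟩, by rw [hef]⟩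
      rw [h2, hef]
      simp [listCase, hmf]
  refine ⟨?_, ?_, fun E hE => ?_⟩
  · have h1 := hl.nodup.of_map
    refine (h1.filter _).map_on fun x hx y hy hxy => ?_
    rw [List.mem_filter, Bool.and_eq_true] at hx hy
    exact List.inj_on_of_nodup_map hl.nodup hx.1 hy.1
      (Prod.ext (hx.2.1.trans hy.2.1.symm) hxy)
  · rw [hsolve]
    exact Finset.filter_subset _ _
  · have hle : ∀ E ⊆ I.db.toFinset, ∑ o ∈ I.nodes.toFinset, I.assignCost φ.lhs ψ.lhs (m o) o ≤
        I.intCost φ ψ E := by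
      intro E hE
      obtain ⟨τ, hτ, hτi, hτc⟩ := exists_assignment h hφ hψ hE
      have h1 := hopt τ hτ hτi
      have h2 : I.scale ∣ ∑ o ∈ I.nodes.toFinset, I.assignCost φ.lhs ψ.lhs (m o) o :=
        Finset.dvd_sum fun o _ => scale_dvd_assignCost _ _ _ _
      have h3 : I.scale ∣ ∑ i ∈ I.nodes.toFinset, I.assignCost φ.lhs ψ.lhs i (τ i) :=
        Finset.dvd_sum fun o _ => scale_dvd_assignCost _ _ _ _
      rw [← hτc]
      obtain ⟨x, hx⟩ := h2
      obtain ⟨y, hy⟩ := h3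
      -- With N nodes, (N + 1)x ≤ (N + 1)y + N forces x ≤ y, so the error of the auction disappears.
      rw [hx, hy, scale_eq] at h1 ⊢
      refine Nat.mul_le_mul_left _ ?_
      by_contra hlt
      have := Nat.mul_le_mul_left (I.nodes.length + 1) (not_le.1 hlt)
      rw [Nat.succ_eq_add_one, mul_add] at this
      omega
    have hempty : I.intCost φ ψ ∅ = ∑ f ∈ I.db.toFinset, I.weight f := by
      have h0 : ∀ χ : FD k, vio ∅ χ = ∅ := fun χ => by
        rw [vio, Finset.powersetCard_eq_empty.2 (by simp), Finset.filter_empty]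
      simp [intCost, h0]
    rw [hsolve]
    refine (intCost_chosen_le h hφ hψ hmaps hinj ?_).trans (hle E hE)
    -- Comparison with the empty subset shows that the assignment found contains no forbidden pair.
    have := hle ∅ (Finset.empty_subset _)
    rw [hempty] at this
    exact this.trans_lt (sum_weight_lt_big h _ _)

/-- The input with the facts `L` and the weights `wF` and `wC`. -/
def ofWeights (φ ψ : FD k) (L : List (Fact k)) (wF : Fact k → Weight) (wC : FD k → Weight) :
    Input k := ⟨wC φ, wC ψ, L.map fun f => (f, wF f)⟩

/-! ### Clearing denominators -/

variable (L : List (Fact k)) (wF : Fact k → Weight) (wC : FD k → Weight)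

theorem enc_ofWeights : enc (ofWeights φ ψ L wF wC) = encodeInput [φ, ψ] L wF wC := by
  simp only [ofWeights, enc, encodeInput, List.map_map, List.map_cons, List.map_nil]
  rfl

theorem db_ofWeights : (ofWeights φ ψ L wF wC).db = L := by
  simp [ofWeights, db, Function.comp_def]

/-- A common denominator of all weights. -/
def denominator (I : Input k) : ℕ :=
  I.scale * (I.wX.den * I.wY.den * (I.facts.map fun x => x.2.den).prod)

theorem denominator_pos (I : Input k) : 0 < I.denominator := by
  refine Nat.mul_pos (by simp [scale]) (Nat.mul_pos (Nat.mul_pos I.wX.den_pos I.wY.den_pos) ?_)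
  refine List.prod_pos fun x hx => ?_
  obtain ⟨y, -, rfl⟩ := List.mem_map.1 hx
  exact y.2.den_pos

theorem costX_eq (I : Input k) : (I.costX : ℚ) = I.denominator * I.wX.value := by
  have h := I.wX.den_pos
  rw [costX, denominator, Weight.value]
  push_cast
  field_simp

theorem costY_eq (I : Input k) : (I.costY : ℚ) = I.denominator * I.wY.value := by
  have h := I.wY.den_pos
  rw [costY, denominator, Weight.value]
  push_cast
  field_simp

-- Replacing the denominator of f by its numerator in the product of all denominators multiplies the
-- product by the weight of f; division is thus avoided in the algorithm. As L has no repetitions,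
-- only one factor changes.
variable {L} in
theorem weight_eq (hL : L.Nodup) {f : Fact k} (hf : f ∈ L) :
    ((ofWeights φ ψ L wF wC).weight f : ℚ) =
      (ofWeights φ ψ L wF wC).denominator * (wF f).value := by
  have h1 : (L.map fun g => if g = f then (wF g).num else (wF g).den).prod * (wF f).den =
      (wF f).num * (L.map fun g => (wF g).den).prod := by
    rw [← List.prod_toFinset _ hL, ← List.prod_toFinset _ hL,
      ← Finset.mul_prod_erase _ _ (List.mem_toFinset.2 hf),
      ← Finset.mul_prod_erase _ (fun g => (wF g).den) (List.mem_toFinset.2 hf), if_pos rfl,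
      Finset.prod_congr rfl fun g hg => if_neg (Finset.ne_of_mem_erase hg)]
    ring
  have h2 : ((wF f).den : ℚ) ≠ 0 := by exact_mod_cast (wF f).den_pos.ne'
  rw [weight, denominator, Weight.value, mul_div_assoc', eq_div_iff h2]
  simp only [ofWeights, List.map_map, Function.comp_def, Bool.cond_decide, agree_univ_iff]
  norm_cast
  rw [mul_assoc, mul_assoc _ _ (wF f).den, h1]
  ring

variable {L} in
theorem intCost_eq (h : IsMatchingConstraint φ ψ) (hL : L.Nodup) (E : Finset (Fact k)) :
    ((ofWeights φ ψ L wF wC).intCost φ ψ E : ℚ) =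
      (ofWeights φ ψ L wF wC).denominator * cost [φ, ψ].toFinset wF wC L.toFinset E := by
  have h1 : ∑ χ ∈ [φ, ψ].toFinset, (wC χ).value * ((vio E χ).card : ℚ) =
      (wC φ).value * (vio E φ).card + (wC ψ).value * (vio E ψ).card := by
    -- If the two FDs coincide, the set of FDs has one element, while `intCost` counts both weights.
    -- Then X = X ∪ X' is the whole schema, so there are no violations and both sides vanish.
    rcases eq_or_ne φ ψ with rfl | hne
    · have hl : φ.lhs = Finset.univ := by simpa using h.2.2
      have : vio E φ = ∅ := by
        rw [vio, Finset.filter_eq_empty_iff]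
        rintro p - ⟨f, -, g, -, ha, hna⟩
        rw [hl, agree_univ_iff] at ha
        exact hna (ha ▸ agree_refl _ _)
      simp [this]
    · simp [hne]
  rw [cost, h1, intCost, db_ofWeights]
  push_cast
  rw [Finset.sum_congr rfl fun f hf =>
    weight_eq wF wC hL (List.mem_toFinset.1 (Finset.mem_sdiff.1 hf).1), ← Finset.mul_sum,
    costX_eq, costY_eq]
  simp only [ofWeights]
  ring

end Input

end Main

end SoftRepair

/-- For every relation schema and every pair of FDs over it that is a matching constraint, soft
repairing is solvable in polynomial time (in the size of the database and of all weights). -/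
theorem mainTheorem1 (k : ℕ) (φ ψ : SoftRepair.FD k)
    (h : SoftRepair.IsMatchingConstraint φ ψ) :
    SoftRepair.SolvableInPolyTime [φ, ψ] := by
  obtain ⟨p, T, ⟨q, hq⟩, hp⟩ := SoftRepair.PolyTime.solve φ.lhs ψ.lhs
  refine ⟨p, q, fun L wF wC hL => ?_⟩
  set I := SoftRepair.Input.ofWeights φ ψ L wF wC with hI
  have hdb : I.db = L := SoftRepair.Input.db_ofWeights L wF wC
  obtain ⟨hnd, hsub, hopt⟩ := SoftRepair.Input.solve_spec (I := I) (hdb.symm ▸ hL) h.1 h.2.1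
  obtain ⟨t, ht, hrun⟩ := hp I
  rw [hdb] at hsub hopt
  have henc := SoftRepair.Input.enc_ofWeights (φ := φ) (ψ := ψ) L wF wC
  refine ⟨I.solve φ.lhs ψ.lhs, t, hnd, henc ▸ hrun, ?_, hsub, fun E hE => ?_⟩
  · rw [← henc]
    exact ht.trans (hq I)
  · have h1 := hopt E hE
    rw [← Nat.cast_le (α := ℚ), hI, SoftRepair.Input.intCost_eq wF wC h hL,
      SoftRepair.Input.intCost_eq wF wC h hL] at h1
    exact le_of_mul_le_mul_left h1
      (by exact_mod_cast SoftRepair.Input.denominator_pos _)
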